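/- Let $n\ge 1$, $\alpha>0$, $\beta>0$, and let $X_1,\dots,X_n$ be i.i.d. Gamma random variables with shape $\alpha$ and rate $\beta$, i.e. with density $\frac{\beta^\alpha}{\Gamma(\alpha)}x^{\alpha-1}e^{-\beta x}$ on $x>0$. Let $\lambda=(\lambda_1,\dots,\lambda_n)$ and $\mu=(\mu_1,\dots,\mu_n)$ be real vectors such that $\lambda$ majorizes $\mu$ (written $\mu\prec\lambda$), in the sense that $\lambda_1\ge\lambda_2\ge\dots\ge\lambda_n\ge 0$, $\mu_1\ge\mu_2\ge\dots\ge\mu_n>0$, $\sum_{i=1}^k\mu_i\le\sum_{i=1}^k\lambda_i$ for all $k<n$, and $\sum_{i=1}^n\mu_i=\sum_{i=1}^n\lambda_i$. Let $s$ denote this common sum. Then $$\Pr\Big(\sum_{i=1}^n\mu_iX_i<x\Big)\ \ge\ \Pr\Big(\sum_{i=1}^n\lambda_iX_i<x\Big)\qquad\text{for all } x>\frac{(2\alpha+1)s}{2\beta}.$$ Moreover, the reverse inequality $$\Pr\Big(\sum_{i=1}^n\mu_iX_i<x\Big)\ \le\ \Pr\Big(\sum_{i=1}^n\lambda_iX_i<x\Big)$$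 holds for all $x<\frac{\alpha s}{\beta}$ if $n=2$, and for all $x<\frac{(\alpha-1)s}{\beta}$ if $n\ge 3$ and $\alpha>1$. -/

import Mathlib

open MeasureTheory ProbabilityTheory

/-- `Majorizes lam mu` says that the nonnegative weight vector `lam` majorizes the positive weight
vector `mu`: both are arranged in decreasing order, the partial sums of `mu` over the first `k`
components are at most those of `lam`, and the total sums agree. -/
structure Majorizes {n : ℕ} (lam mu : Fin n → ℝ) : Prop where
  nonneg : ∀ i, 0 ≤ lam i
  pos : ∀ i, 0 < mu i
  antitone_left : Antitone lam
  antitone_right : Antitone mu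
  partial_sum_le : ∀ k : ℕ, k < n →
    ∑ i : Fin n with i.val < k, mu i ≤ ∑ i : Fin n with i.val < k, lam i
  sum_eq : ∑ i, mu i = ∑ i, lam i

/-- The probability `Pr (∑ i, lam i * X i < x)`. -/
noncomputable def combProb {Ω : Type*} [MeasurableSpace Ω] (P : Measure Ω) {n : ℕ}
    (X : Fin n → Ω → ℝ) (lam : Fin n → ℝ) (x : ℝ) : ℝ :=
  P.real {ω | ∑ i, lam i * X i ω < x}

/-!
By scaling take the rate to be `1`. The comparison follows from the sign of the derivative of a
density, by differentiating `F(lam) = P(∑ lam i * G i < x)` along the segment from `lam` to `mu`. If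
`g k` is the density of `∑ lam i * G i` after the shape of `G k` has been raised by one, then
`∂F/∂(lam k) = -α * g k` and `g i - g j = (lam j - lam i) * f'`, where `f` is the density with the
shapes of both `G i` and `G j` raised. Along the segment the weights stay in decreasing order, so if
`f' (x)` has the same sign for all pairs, then `k ↦ g k (x)` is monotone or antitone, and the sign of
the derivative of `F` is given by majorization (`Majorizes.sum_mul_le_of_antitone`).

Now let `f` be the density at `z` of `∑ lam i * G i` for shapes `b i`, and `g k` as above, so that
`f = g k + lam k * g k'` and `z * f = ∑ b k * lam k * g k`.

* Lower range (`densityDeriv_pos`). If `f' ≤ 0` and `b k > 1`, the Cauchy-Schwarz inequality gives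
  `b k * g k ≥ (b k - 1) * f`. Summing, `z ≥ ∑ (b k - 1) * lam k`; below this value `f' > 0`.
* Upper range (`densityDeriv_neg_of_forall`, `densityDeriv_neg`). Among all `lam` in a simplex and
  all `z` beyond a threshold with `f' ≥ 0`, choose a pair with `z` maximal. There `f' = 0`, and `lam`
  maximizes `f' (z)` over the simplex, so `∂f'/∂(lam k) = -b k * g k''` has the same value for all
  `k` with `lam k > 0`. With the identities above this forces
  `z = ∑ b k * lam k - (∑ lam k ^ 3) / ∑ lam k ^ 2`, which is at most `(α + 1 / 2) * s` when two of
  the shapes are `α + 1` and the others `α`.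

To have densities that are smooth in `lam` up to the boundary of the simplex, whatever the shapes,
one uses that `∑ G i` is a gamma variable independent of the proportions `G i / ∑ G j`
(`lintegral_gammaProd_sum`), whose law is a Dirichlet distribution. So the density is the Dirichlet
mean of the bounded smooth kernel `invKernel` at the weighted mean of the proportions
(`kernelMean`), and all identities reduce to a size-bias identity
(`integral_dirichlet_add_single`) and an integration by parts (`integral_dirichlet_by_parts`).
-/

/-! ### Changing the parameters of a gamma measure -/

theorem gammaMeasure_rate_eq_withDensity {a r : ℝ} (hr : 0 < r) :
    gammaMeasure a r = (gammaMeasure a 1).withDensity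
      (fun x ↦ ENNReal.ofReal (r ^ a * Real.exp (-((r - 1) * x)))) := by
  unfold gammaMeasure
  rw [← withDensity_mul _ (by unfold gammaPDF; fun_prop) (by fun_prop)]
  congr 1
  ext x
  rw [Pi.mul_apply]
  rcases lt_or_ge x 0 with hx | hx
  · simp [gammaPDF_of_neg hx]
  · rw [gammaPDF_of_nonneg hx, gammaPDF_of_nonneg hx, ← ENNReal.ofReal_mul' (by positivity)]
    congr 1
    have : Real.exp (-(r * x)) = Real.exp (-(1 * x)) * Real.exp (-((r - 1) * x)) := by
      rw [← Real.exp_add]; ring_nf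
    rw [this, Real.one_rpow]
    ring

theorem gammaMeasure_add_one_eq_withDensity {a : ℝ} (ha : 0 < a) :
    gammaMeasure (a + 1) 1 = (gammaMeasure a 1).withDensity (fun x ↦ ENNReal.ofReal (x / a)) := by
  unfold gammaMeasure
  rw [← withDensity_mul _ (by unfold gammaPDF; fun_prop) (by fun_prop)]
  congr 1
  ext x
  rw [Pi.mul_apply]
  rcases lt_or_ge x 0 with hx | hx
  · simp [gammaPDF_of_neg hx]
  · rw [gammaPDF_of_nonneg hx, gammaPDF_of_nonneg hx, ← ENNReal.ofReal_mul' (by positivity)]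
    congr 1
    rw [Real.Gamma_add_one ha.ne']
    rcases hx.eq_or_lt with rfl | hx
    · simp [Real.zero_rpow ha.ne']
    · rw [add_sub_cancel_right, Real.rpow_sub_one hx.ne']
      have := (Real.Gamma_pos_of_pos ha).ne'
      simp only [Real.one_rpow]
      field_simp

theorem gammaMeasure_eq_map_inv_mul {a r : ℝ} (hr : 0 < r) :
    gammaMeasure a r = (gammaMeasure a 1).map (fun x ↦ r⁻¹ * x) := by
  ext s hs
  rw [Measure.map_apply (by fun_prop) hs]
  unfold gammaMeasure
  rw [withDensity_apply _ hs, withDensity_apply _ (hs.preimage (by fun_prop)),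
    ← lintegral_indicator hs, ← lintegral_indicator (hs.preimage (by fun_prop))]
  have key := Real.map_volume_mul_left (a := r⁻¹) (by positivity)
  have h2 : ∫⁻ x, s.indicator (gammaPDF a r) x =
      ENNReal.ofReal |r|⁻¹ * ∫⁻ x, s.indicator (gammaPDF a r) x
        ∂(Measure.map (r⁻¹ * ·) volume) := by
    rw [key, lintegral_smul_measure, smul_eq_mul, ← mul_assoc, ← ENNReal.ofReal_mul (by positivity)]
    simp [hr.ne']
  have hmeas : Measurable fun x ↦ s.indicator (gammaPDF a r) (r⁻¹ * x) :=
    (Measurable.indicator (by unfold gammaPDF; fun_prop) hs).comp (measurable_const_mul _)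
  rw [h2, lintegral_map (Measurable.indicator (by unfold gammaPDF; fun_prop) hs) (by fun_prop),
    ← lintegral_const_mul _ hmeas]
  congr 1
  ext x
  by_cases h : r⁻¹ * x ∈ s
  · rw [Set.indicator_of_mem h, Set.indicator_of_mem (by simpa using h)]
    rcases lt_or_ge x 0 with hx | hx
    · rw [gammaPDF_of_neg hx, gammaPDF_of_neg (mul_neg_of_pos_of_neg (by positivity) hx), mul_zero]
    · rw [gammaPDF_of_nonneg hx, gammaPDF_of_nonneg (by positivity),
        ← ENNReal.ofReal_mul (by positivity)]
      congr 1
      rw [mul_inv_cancel_left₀ hr.ne', Real.mul_rpow (by positivity) hx, abs_of_pos hr,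
        Real.inv_rpow hr.le, Real.rpow_sub_one hr.ne']
      have := (Real.rpow_pos_of_pos hr a).ne'
      simp only [Real.one_rpow, one_mul]
      field_simp
  · rw [Set.indicator_of_notMem h, Set.indicator_of_notMem (by simpa using h), mul_zero]

theorem gammaMeasure_ae_pos (a r : ℝ) : ∀ᵐ x ∂gammaMeasure a r, 0 < x := by
  unfold gammaMeasure
  rw [ae_withDensity_iff (by unfold gammaPDF; fun_prop)]
  have : ∀ᵐ x : ℝ, x ≠ 0 := by simp [ae_iff]
  filter_upwards [this] with x hx h
  by_contra! hle
  exact h (gammaPDF_of_neg (lt_of_le_of_ne hle hx))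

theorem integral_gammaMeasure (a : ℝ) (ha : 0 < a) (g : ℝ → ℝ) :
    ∫ x, g x ∂gammaMeasure a 1 =
      ∫ x in Set.Ioi 0, (Real.Gamma a)⁻¹ * (x ^ (a - 1) * Real.exp (-x)) * g x := by
  unfold gammaMeasure
  rw [integral_withDensity_eq_integral_toReal_smul (by unfold gammaPDF; fun_prop)
    (by simp [gammaPDF]), ← integral_Ici_eq_integral_Ioi, ← integral_indicator measurableSet_Ici]
  congr 1
  ext x
  rcases lt_or_ge x 0 with hx | hx
  · rw [gammaPDF_of_neg hx, Set.indicator_of_notMem (by simpa using hx)]; simp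
  · rw [gammaPDF_of_nonneg hx, Set.indicator_of_mem (by simpa using hx), ENNReal.toReal_ofReal]
    · simp only [Real.one_rpow, one_mul, one_div, smul_eq_mul]
      ring
    · have := (Real.Gamma_pos_of_pos ha)
      positivity

/-- Integration by parts against the gamma density `t ^ (a - 1) * exp (-t)`. -/
theorem integral_gammaMeasure_sub_mul_add_mul_deriv {a : ℝ} (ha : 0 < a) {φ φ' : ℝ → ℝ} {C : ℝ}
    (hφ : ∀ t, 0 < t → HasDerivAt φ (φ' t) t) (hm : Measurable φ')
    (hC : ∀ t, 0 < t → |φ t| ≤ C) (hC' : ∀ t, 0 < t → |t * φ' t| ≤ C) :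
    ∫ t, (a - t) * φ t + t * φ' t ∂gammaMeasure a 1 = 0 := by
  rw [integral_gammaMeasure a ha]
  simp_rw [mul_assoc]
  rw [integral_const_mul]
  have hcont : ContinuousWithinAt
      (fun t ↦ if 0 < t then t ^ a * Real.exp (-t) * φ t else 0) (Set.Ici 0) 0 := by
    have : Filter.Tendsto (fun t : ℝ ↦ t ^ a * C) (nhdsWithin 0 (Set.Ici 0)) (nhds 0) := by
      have h := ((Real.continuousAt_rpow_const 0 a (Or.inr ha.le)).mul_const C).tendsto
      simp only [Real.zero_rpow ha.ne', zero_mul] at h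
      exact h.mono_left nhdsWithin_le_nhds
    rw [ContinuousWithinAt]
    simp only [lt_irrefl, if_false]
    refine squeeze_zero_norm' ?_ this
    filter_upwards [self_mem_nhdsWithin] with t ht
    split_ifs with h
    · rw [Real.norm_eq_abs, abs_mul, abs_of_pos (by positivity)]
      have h1 : Real.exp (-t) ≤ 1 := by simp [h.le]
      have h2 := hC t h
      calc t ^ a * Real.exp (-t) * |φ t| ≤ t ^ a * 1 * C := by gcongr
        _ = _ := by ring
    · have : t = 0 := le_antisymm (not_lt.1 h) ht
      simp [this, Real.zero_rpow ha.ne']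
  have hC0 : 0 ≤ C := (abs_nonneg _).trans (hC 1 one_pos)
  have hint : IntegrableOn (fun t : ℝ ↦ C * (a * (Real.exp (-t) * t ^ (a - 1)))
      + C * (Real.exp (-t) * t ^ ((a + 1) - 1)) + C * (Real.exp (-t) * t ^ (a - 1)))
      (Set.Ioi 0) :=
    (((Real.GammaIntegral_convergent ha).const_mul a |>.const_mul C).add
      ((Real.GammaIntegral_convergent (by linarith : 0 < a + 1)).const_mul C)).add
      ((Real.GammaIntegral_convergent ha).const_mul C)
  have hcφ : ContinuousOn φ (Set.Ioi 0) := fun t ht ↦ (hφ t ht).continuousAt.continuousWithinAt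
  have key := integral_Ioi_of_hasDerivAt_of_tendsto (a := (0 : ℝ)) (m := 0)
    (f := fun t ↦ if 0 < t then t ^ a * Real.exp (-t) * φ t else 0)
    (f' := fun t ↦ t ^ (a - 1) * (Real.exp (-t) * ((a - t) * φ t + t * φ' t))) hcont ?_ ?_ ?_
  · rw [key]; simp
  · intro t ht
    have ht : 0 < t := ht
    have h1 : HasDerivAt (fun t ↦ t ^ a * Real.exp (-t) * φ t)
        (t ^ (a - 1) * (Real.exp (-t) * ((a - t) * φ t + t * φ' t))) t := by
      refine (((Real.hasDerivAt_rpow_const (p := a) (Or.inl ht.ne')).fun_mul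
        ((hasDerivAt_neg t).exp)).fun_mul (hφ t ht)).congr_deriv ?_
      rw [Real.rpow_sub_one ht.ne']
      field_simp
      ring
    refine h1.congr_of_eventuallyEq ?_
    filter_upwards [lt_mem_nhds ht] with s hs
    simp [hs]
  · refine Integrable.mono' hint ?_ ?_
    · have : AEStronglyMeasurable φ (volume.restrict (Set.Ioi 0)) :=
        hcφ.aestronglyMeasurable measurableSet_Ioi
      exact (Measurable.aestronglyMeasurable (by fun_prop)).mul
        ((Measurable.aestronglyMeasurable (by fun_prop)).mul
          (((Measurable.aestronglyMeasurable (by fun_prop)).mul this).add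
            (Measurable.aestronglyMeasurable (by fun_prop))))
    · refine (ae_restrict_iff' measurableSet_Ioi).2 (ae_of_all _ fun t ht ↦ ?_)
      have ht : 0 < t := ht
      have h1 : |(a - t) * φ t + t * φ' t| ≤ (a + t) * C + C := by
        refine (abs_add_le _ _).trans (add_le_add ?_ (hC' t ht))
        rw [abs_mul]
        have : |a - t| ≤ a + t := by rw [abs_le]; constructor <;> linarith
        exact mul_le_mul this (hC t ht) (abs_nonneg _) (by positivity)
      rw [Real.norm_eq_abs, abs_mul, abs_mul, abs_of_pos (Real.exp_pos _),
        abs_of_pos (Real.rpow_pos_of_pos ht _), add_sub_cancel_right]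
      have h2 : t ^ a = t ^ (a - 1) * t := by rw [Real.rpow_sub_one ht.ne']; field_simp
      calc t ^ (a - 1) * (Real.exp (-t) * |(a - t) * φ t + t * φ' t|)
          ≤ t ^ (a - 1) * (Real.exp (-t) * ((a + t) * C + C)) := by gcongr
        _ = _ := by rw [h2]; ring
  · have h := tendsto_rpow_mul_exp_neg_mul_atTop_nhds_zero a 1 one_pos
    have h := h.mul_const C
    rw [zero_mul] at h
    refine squeeze_zero_norm' ?_ h
    filter_upwards [Filter.eventually_gt_atTop 0] with t ht
    rw [if_pos ht, Real.norm_eq_abs, abs_mul, abs_of_pos (by positivity)]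
    have h2 := hC t ht
    rw [neg_one_mul]
    gcongr

/-! ### Products of gamma measures -/

theorem pi_withDensity_eq {ι : Type*} [Fintype ι] {E : ι → Type*} [∀ i, MeasurableSpace (E i)]
    (μ : ∀ i, Measure (E i)) [∀ i, IsProbabilityMeasure (μ i)] (f : ∀ i, E i → ENNReal)
    (hf : ∀ i, Measurable (f i)) [∀ i, SigmaFinite ((μ i).withDensity (f i))] :
    Measure.pi (fun i ↦ (μ i).withDensity (f i)) =
      (Measure.pi μ).withDensity (fun x ↦ ∏ i, f i (x i)) := by
  refine Measure.pi_eq fun s hs ↦ ?_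
  rw [withDensity_apply _ (MeasurableSet.univ_pi hs),
    ← lintegral_indicator (MeasurableSet.univ_pi hs)]
  have h : (Set.univ.pi s).indicator (fun x ↦ ∏ i, f i (x i)) =
      fun x ↦ ∏ i, (s i).indicator (f i) (x i) := by
    ext x
    by_cases hx : x ∈ Set.univ.pi s
    · rw [Set.indicator_of_mem hx]
      exact Finset.prod_congr rfl fun i _ ↦ (Set.indicator_of_mem (hx i trivial) _).symm
    · rw [Set.indicator_of_notMem hx]
      simp only [Set.mem_univ_pi, not_forall] at hx
      obtain ⟨i, hi⟩ := hx
      exact (Finset.prod_eq_zero (Finset.mem_univ i) (Set.indicator_of_notMem hi _)).symm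
  have hm : ∀ i, Measurable ((s i).indicator (f i)) := fun i ↦ (hf i).indicator (hs i)
  rw [h, lintegral_prod_eq_prod_lintegral_of_indepFun Finset.univ
    (fun i (x : ∀ i, E i) ↦ (s i).indicator (f i) (x i))
    (iIndepFun_pi fun i ↦ (hm i).aemeasurable)
    (fun i ↦ (hm i).comp (measurable_pi_apply i))]
  refine Finset.prod_congr rfl fun i _ ↦ ?_
  rw [withDensity_apply _ (hs i), ← lintegral_indicator (hs i),
    ← (measurePreserving_eval μ i).lintegral_comp (hm i)]

section

variable {ι : Type*} [Fintype ι]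

/-- The law of a vector of independent gamma variables with shapes `a i` and rate `1`. -/
noncomputable def gammaProd (a : ι → ℝ) : Measure (ι → ℝ) :=
  Measure.pi fun i ↦ gammaMeasure (a i) 1

theorem isProbabilityMeasure_gammaProd {a : ι → ℝ} (ha : ∀ i, 0 < a i) :
    IsProbabilityMeasure (gammaProd a) := by
  have := fun i ↦ isProbabilityMeasure_gammaMeasure (ha i) one_pos
  unfold gammaProd
  infer_instance

theorem gammaProd_ae_pos {a : ι → ℝ} (ha : ∀ i, 0 < a i) :
    ∀ᵐ x ∂gammaProd a, ∀ i, 0 < x i := by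
  have := fun i ↦ isProbabilityMeasure_gammaMeasure (ha i) one_pos
  exact ae_all_iff.2 fun i ↦
    (Measure.tendsto_eval_ae_ae (μ := fun i ↦ gammaMeasure (a i) 1) (i := i)).eventually
      (gammaMeasure_ae_pos (a i) 1)

theorem pi_gammaMeasure_eq_map_smul {a : ι → ℝ} (ha : ∀ i, 0 < a i) {r : ℝ} (hr : 0 < r) :
    Measure.pi (fun i ↦ gammaMeasure (a i) r) = (gammaProd a).map (fun x ↦ r⁻¹ • x) := by
  have := fun i ↦ isProbabilityMeasure_gammaMeasure (ha i) one_pos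
  have := fun i ↦ isProbabilityMeasure_gammaMeasure (ha i) hr
  have e : (fun i ↦ gammaMeasure (a i) r) =
      fun i ↦ (gammaMeasure (a i) 1).map (fun x ↦ r⁻¹ * x) :=
    funext fun i ↦ gammaMeasure_eq_map_inv_mul hr
  have : ∀ i, SigmaFinite ((gammaMeasure (a i) 1).map (fun x ↦ r⁻¹ * x)) := fun i ↦ by
    rw [← gammaMeasure_eq_map_inv_mul hr]; infer_instance
  rw [e, ← Measure.pi_map_pi fun i ↦ by fun_prop]
  rfl

theorem pi_gammaMeasure_eq_withDensity {a : ι → ℝ} (ha : ∀ i, 0 < a i) {r : ℝ} (hr : 0 < r) :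
    Measure.pi (fun i ↦ gammaMeasure (a i) r) = (gammaProd a).withDensity
      (fun x ↦ ENNReal.ofReal (r ^ (∑ i, a i) * Real.exp (-((r - 1) * ∑ i, x i)))) := by
  have := fun i ↦ isProbabilityMeasure_gammaMeasure (ha i) one_pos
  have := fun i ↦ isProbabilityMeasure_gammaMeasure (ha i) hr
  have : ∀ i, SigmaFinite ((gammaMeasure (a i) 1).withDensity
      (fun x ↦ ENNReal.ofReal (r ^ (a i) * Real.exp (-((r - 1) * x))))) := fun i ↦ by
    rw [← gammaMeasure_rate_eq_withDensity hr]; infer_instance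
  simp_rw [fun i ↦ gammaMeasure_rate_eq_withDensity (a := a i) hr]
  rw [pi_withDensity_eq _ _ (fun i ↦ by fun_prop)]
  congr 1
  ext x
  rw [← ENNReal.ofReal_prod_of_nonneg fun i _ ↦ by positivity, Finset.prod_mul_distrib,
    ← Real.rpow_sum_of_pos hr, ← Real.exp_sum, Finset.mul_sum, Finset.sum_neg_distrib]

theorem gammaProd_add_single_eq_withDensity [DecidableEq ι] {a : ι → ℝ} (ha : ∀ i, 0 < a i)
    (k : ι) : gammaProd (a + Pi.single k 1) =
      (gammaProd a).withDensity (fun x ↦ ENNReal.ofReal (x k / a k)) := by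
  have := fun i ↦ isProbabilityMeasure_gammaMeasure (ha i) one_pos
  set f : ι → ℝ → ENNReal := fun i x ↦ if i = k then ENNReal.ofReal (x / a i) else 1 with hf
  have e : ∀ i, gammaMeasure ((a + Pi.single k 1 : ι → ℝ) i) 1 =
      (gammaMeasure (a i) 1).withDensity (f i) := fun i ↦ by
    by_cases h : i = k
    · subst h
      simp only [Pi.add_apply, Pi.single_eq_same, hf, if_true]
      exact gammaMeasure_add_one_eq_withDensity (ha i)
    · simp only [hf, h, if_false, Pi.add_apply, Pi.single_eq_of_ne h, add_zero]
      exact withDensity_one.symm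
  have ha' : ∀ i, 0 < (a + Pi.single k 1 : ι → ℝ) i := fun i ↦ by
    by_cases h : i = k
    · subst h; simp; linarith [ha i]
    · simp [h, ha i]
  have := fun i ↦ isProbabilityMeasure_gammaMeasure (ha' i) one_pos
  have : ∀ i, SigmaFinite ((gammaMeasure (a i) 1).withDensity (f i)) := fun i ↦ by
    rw [← e]; infer_instance
  unfold gammaProd
  simp_rw [e]
  rw [pi_withDensity_eq _ _ (fun i ↦ by by_cases h : i = k <;> simp only [hf, h, if_true, if_false] <;> fun_prop)]
  congr 1
  ext x
  simp [hf]

/-! ### The sum of independent gamma variables is independent of their proportions -/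

theorem lintegral_gammaMeasure (A : ℝ) {g : ℝ → ENNReal} (hg : Measurable g) :
    ∫⁻ t, g t ∂gammaMeasure A 1 = ∫⁻ t in Set.Ioi 0,
      ENNReal.ofReal ((Real.Gamma A)⁻¹ * t ^ (A - 1) * Real.exp (-t)) * g t := by
  unfold gammaMeasure
  rw [lintegral_withDensity_eq_lintegral_mul _ (by unfold gammaPDF; fun_prop) hg,
    ← lintegral_indicator measurableSet_Ioi]
  refine lintegral_congr_ae ?_
  have : ∀ᵐ x : ℝ, x ≠ 0 := by simp [ae_iff]
  filter_upwards [this] with x hx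
  rw [Pi.mul_apply]
  rcases hx.lt_or_gt with h | h
  · rw [gammaPDF_of_neg h, Set.indicator_of_notMem (by simpa using h.le), zero_mul]
  · rw [gammaPDF_of_nonneg h.le, Set.indicator_of_mem (by simpa using h)]
    simp

theorem setLIntegral_gammaPDF {A s : ℝ} (hA : 0 < A) (hs : 0 < s) :
    ∫⁻ u in Set.Ioi 0,
      ENNReal.ofReal (s ^ A / Real.Gamma A * u ^ (A - 1) * Real.exp (-(s * u))) = 1 := by
  rw [← lintegral_gammaPDF_eq_one hA hs, ← lintegral_indicator measurableSet_Ioi]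
  refine lintegral_congr_ae ?_
  have : ∀ᵐ x : ℝ, x ≠ 0 := by simp [ae_iff]
  filter_upwards [this] with x hx
  rcases hx.lt_or_gt with h | h
  · rw [gammaPDF_of_neg h, Set.indicator_of_notMem (by simpa using h.le)]
  · rw [gammaPDF_of_nonneg h.le, Set.indicator_of_mem (by simpa using h)]

theorem setLIntegral_comp_const_div {s : ℝ} (hs : 0 < s) (g : ℝ → ENNReal) :
    ∫⁻ t in Set.Ioi 0, g t = ∫⁻ u in Set.Ioi 0, ENNReal.ofReal (s / u ^ 2) * g (s / u) := by
  have himg : (fun u ↦ s / u) '' Set.Ioi 0 = Set.Ioi 0 := by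
    ext t
    constructor
    · rintro ⟨u, hu, rfl⟩
      exact div_pos hs hu
    · intro ht
      have ht : 0 < t := ht
      exact ⟨s / t, div_pos hs ht, by simp only; field_simp⟩
  have := lintegral_image_eq_lintegral_abs_deriv_mul (s := Set.Ioi (0 : ℝ)) (f := fun u ↦ s / u)
    (f' := fun u ↦ -s / u ^ 2) measurableSet_Ioi ?_ ?_ g
  · rw [himg] at this
    rw [this]
    refine setLIntegral_congr_fun measurableSet_Ioi fun u hu ↦ ?_
    have hu : 0 < u := hu
    rw [abs_div, abs_neg, abs_of_pos hs, abs_of_pos (by positivity : 0 < u ^ 2)]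
  · intro u hu
    have hu : u ≠ 0 := ne_of_gt hu
    have := ((hasDerivAt_const u s).fun_div (hasDerivAt_id' u) hu).hasDerivWithinAt
      (s := Set.Ioi 0)
    simpa using this
  · intro u hu v hv h
    have hu : 0 < u := hu
    have hv : 0 < v := hv
    have h : s / u = s / v := h
    field_simp at h
    exact h.symm

/-- If `Φ t` is homogeneous of degree `0`, then the sum of independent gamma variables may be
replaced by an independent gamma variable. The proof inserts the factor
`1 = ∫ s ^ A / Γ(A) * u ^ (A - 1) * exp (-s * u) du`, where `s` is the sum, absorbs
`exp (-s * (u - 1))` by changing all rates to `u`, rescales by `u`, and substitutes `t = s / u`. -/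
theorem lintegral_gammaProd_sum [Nonempty ι] {a : ι → ℝ} (ha : ∀ i, 0 < a i)
    {Φ : ℝ × (ι → ℝ) → ENNReal} (hΦ : Measurable Φ)
    (hom : ∀ c : ℝ, 0 < c → ∀ t x, Φ (t, c • x) = Φ (t, x)) :
    ∫⁻ x, Φ (∑ i, x i, x) ∂gammaProd a =
      ∫⁻ x, ∫⁻ t, Φ (t, x) ∂gammaMeasure (∑ i, a i) 1 ∂gammaProd a := by
  have := isProbabilityMeasure_gammaProd ha
  set A := ∑ i, a i with hAdef
  have hA : 0 < A := Finset.sum_pos (fun i _ ↦ ha i) Finset.univ_nonempty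
  have hG := Real.Gamma_pos_of_pos hA
  have hpos : ∀ᵐ x ∂gammaProd a, 0 < ∑ i, x i := by
    filter_upwards [gammaProd_ae_pos ha] with x hx
    exact Finset.sum_pos (fun i _ ↦ hx i) Finset.univ_nonempty
  have hsm : Measurable fun x : ι → ℝ ↦ ∑ i, x i := by fun_prop
  have hΦs : Measurable fun x : ι → ℝ ↦ Φ (∑ i, x i, x) := hΦ.comp (by fun_prop)
  obtain ⟨h, hh⟩ : ∃ h : ℝ → ℝ → ENNReal, h = fun s u ↦
    ENNReal.ofReal (s ^ A / Real.Gamma A * u ^ (A - 1) * Real.exp (-(s * u))) := ⟨_, rfl⟩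
  have hhm : Measurable fun p : ℝ × ℝ ↦ h p.1 p.2 := by simp only [hh]; fun_prop
  obtain ⟨w, hw⟩ : ∃ w : ℝ → ℝ → ENNReal, w = fun s u ↦
    ENNReal.ofReal (s ^ A * Real.exp (-s) * u⁻¹ / Real.Gamma A) := ⟨_, rfl⟩
  have hwm : Measurable fun p : ℝ × ℝ ↦ w p.1 p.2 := by simp only [hw]; fun_prop
  calc ∫⁻ x : ι → ℝ, Φ (∑ i, x i, x) ∂gammaProd a
      = ∫⁻ x : ι → ℝ, (∫⁻ u : ℝ in Set.Ioi 0, Φ (∑ i, x i, x) * h (∑ i, x i) u) ∂gammaProd a := by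
        refine lintegral_congr_ae ?_
        filter_upwards [hpos] with x hx
        rw [lintegral_const_mul _ (by simp only [hh]; fun_prop), hh, setLIntegral_gammaPDF hA hx,
          mul_one]
    _ = ∫⁻ u : ℝ in Set.Ioi 0, (∫⁻ x : ι → ℝ, Φ (∑ i, x i, x) * h (∑ i, x i) u ∂gammaProd a) := by
        refine lintegral_lintegral_swap (Measurable.aemeasurable ?_)
        have m1 : Measurable fun p : (ι → ℝ) × ℝ ↦ Φ (∑ i, p.1 i, p.1) := hΦs.comp measurable_fst
        have m2 : Measurable fun p : (ι → ℝ) × ℝ ↦ h (∑ i, p.1 i) p.2 :=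
          hhm.comp (g := fun p : ℝ × ℝ ↦ h p.1 p.2)
            ((hsm.comp measurable_fst).prodMk measurable_snd)
        exact m1.mul m2
    _ = ∫⁻ u : ℝ in Set.Ioi 0,
          (∫⁻ x : ι → ℝ, Φ ((∑ i, x i) / u, x) * w ((∑ i, x i) / u) u ∂gammaProd a) := by
        refine setLIntegral_congr_fun measurableSet_Ioi fun u hu ↦ ?_
        have hu : 0 < u := hu
        have hmw : Measurable fun x : ι → ℝ ↦ Φ (∑ i, x i, x) * w (∑ i, x i) u :=
          hΦs.mul (hwm.comp (g := fun p : ℝ × ℝ ↦ w p.1 p.2) (hsm.prodMk measurable_const))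
        have e1 : ∫⁻ x : ι → ℝ, Φ (∑ i, x i, x) * h (∑ i, x i) u ∂gammaProd a =
            ∫⁻ x : ι → ℝ, Φ (∑ i, x i, x) * w (∑ i, x i) u
              ∂Measure.pi (fun i ↦ gammaMeasure (a i) u) := by
          rw [pi_gammaMeasure_eq_withDensity ha hu,
            lintegral_withDensity_eq_lintegral_mul _ (by fun_prop) hmw]
          refine lintegral_congr_ae ?_
          filter_upwards [hpos] with x hx
          rw [Pi.mul_apply, mul_left_comm]
          congr 1
          simp only [hh, hw]
          rw [← ENNReal.ofReal_mul (by positivity)]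
          congr 1
          have : Real.exp (-((∑ i, x i) * u)) =
              Real.exp (-((u - 1) * ∑ i, x i)) * Real.exp (-∑ i, x i) := by
            rw [← Real.exp_add]; ring_nf
          rw [this, Real.rpow_sub_one hu.ne']
          ring
        rw [e1, pi_gammaMeasure_eq_map_smul ha hu, lintegral_map hmw (by fun_prop)]
        refine lintegral_congr fun x ↦ ?_
        have e2 : ∑ i, (u⁻¹ • x) i = (∑ i, x i) / u := by
          simp only [Pi.smul_apply, smul_eq_mul, ← Finset.mul_sum]
          ring
        rw [e2, hom _ (by positivity)]
    _ = ∫⁻ x : ι → ℝ, (∫⁻ u : ℝ in Set.Ioi 0,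
          Φ ((∑ i, x i) / u, x) * w ((∑ i, x i) / u) u) ∂gammaProd a := by
        refine lintegral_lintegral_swap (Measurable.aemeasurable ?_)
        have hd : Measurable fun p : ℝ × (ι → ℝ) ↦ (∑ i, p.2 i) / p.1 :=
          (hsm.comp measurable_snd).div measurable_fst
        have m1 : Measurable fun p : ℝ × (ι → ℝ) ↦ Φ ((∑ i, p.2 i) / p.1, p.2) :=
          hΦ.comp (hd.prodMk measurable_snd)
        have m2 : Measurable fun p : ℝ × (ι → ℝ) ↦ w ((∑ i, p.2 i) / p.1) p.1 :=
          hwm.comp (g := fun p : ℝ × ℝ ↦ w p.1 p.2) (hd.prodMk measurable_fst)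
        exact m1.mul m2
    _ = _ := by
        refine lintegral_congr_ae ?_
        filter_upwards [hpos] with x hx
        have hΦx : Measurable fun t ↦ Φ (t, x) := hΦ.comp (by fun_prop)
        rw [lintegral_gammaMeasure A hΦx]
        refine Eq.trans ?_ (setLIntegral_comp_const_div hx fun t ↦
          ENNReal.ofReal ((Real.Gamma A)⁻¹ * t ^ (A - 1) * Real.exp (-t)) * Φ (t, x)).symm
        refine setLIntegral_congr_fun measurableSet_Ioi fun u hu ↦ ?_
        have hu : 0 < u := hu
        simp only [hw]
        rw [← mul_assoc, ← ENNReal.ofReal_mul (by positivity), mul_comm]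
        congr 2
        rw [Real.rpow_sub_one (by positivity)]
        field_simp

/-! ### The Dirichlet distribution -/

/-- The proportions of the coordinates of `x` in their sum. -/
noncomputable def proportions (x : ι → ℝ) : ι → ℝ := (∑ i, x i)⁻¹ • x

@[fun_prop]
theorem measurable_proportions : Measurable (proportions : (ι → ℝ) → ι → ℝ) := by
  unfold proportions; fun_prop

theorem proportions_smul {c : ℝ} (hc : 0 < c) (x : ι → ℝ) :
    proportions (c • x) = proportions x := by
  ext i
  simp only [proportions, Pi.smul_apply, smul_eq_mul, ← Finset.mul_sum]
  field_simp

/-- The Dirichlet distribution with parameters `a i`, realised as the law of the proportions of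
independent gamma variables. -/
noncomputable def dirichlet (a : ι → ℝ) : Measure (ι → ℝ) := (gammaProd a).map proportions

theorem isProbabilityMeasure_dirichlet {a : ι → ℝ} (ha : ∀ i, 0 < a i) :
    IsProbabilityMeasure (dirichlet a) := by
  have := isProbabilityMeasure_gammaProd ha
  exact Measure.isProbabilityMeasure_map (by fun_prop)

theorem dirichlet_ae [Nonempty ι] {a : ι → ℝ} (ha : ∀ i, 0 < a i) :
    ∀ᵐ u ∂dirichlet a, (∀ i, 0 < u i) ∧ ∑ i, u i = 1 := by
  unfold dirichlet
  rw [ae_map_iff (by fun_prop) (by measurability)]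
  filter_upwards [gammaProd_ae_pos ha] with x hx
  have hs : 0 < ∑ i, x i := Finset.sum_pos (fun i _ ↦ hx i) Finset.univ_nonempty
  refine ⟨fun i ↦ mul_pos (inv_pos.2 hs) (hx i), ?_⟩
  simp only [proportions, Pi.smul_apply, smul_eq_mul, ← Finset.mul_sum]
  exact inv_mul_cancel₀ hs.ne'

theorem integral_dirichlet (a : ι → ℝ) {f : (ι → ℝ) → ℝ} (hf : Measurable f) :
    ∫ u, f u ∂dirichlet a = ∫ x, f (proportions x) ∂gammaProd a :=
  integral_map (by fun_prop) hf.aestronglyMeasurable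

theorem map_sum_proportions_gammaProd [Nonempty ι] {a : ι → ℝ} (ha : ∀ i, 0 < a i) :
    (gammaProd a).map (fun x ↦ (∑ i, x i, proportions x)) =
      (gammaMeasure (∑ i, a i) 1).prod (dirichlet a) := by
  have := isProbabilityMeasure_dirichlet ha
  have := isProbabilityMeasure_gammaMeasure
    (Finset.sum_pos (fun i _ ↦ ha i) Finset.univ_nonempty : 0 < ∑ i, a i) one_pos
  ext s hs
  rw [Measure.map_apply (by fun_prop) hs, Measure.prod_apply_symm hs, dirichlet,
    lintegral_map (measurable_measure_prodMk_right hs) (by fun_prop),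
    ← lintegral_indicator_one (hs.preimage (by fun_prop))]
  have hm : Measurable fun p : ℝ × (ι → ℝ) ↦ (p.1, proportions p.2) := by fun_prop
  have := lintegral_gammaProd_sum ha
    (Φ := fun p ↦ s.indicator (fun _ ↦ 1) (p.1, proportions p.2))
    ((measurable_const.indicator hs).comp hm)
    (fun c hc t x ↦ by simp only [proportions_smul hc])
  refine Eq.trans ?_ (this.trans (lintegral_congr fun x ↦ ?_))
  · rfl
  · rw [← lintegral_indicator_one (hs.preimage (by fun_prop))]
    rfl

theorem integral_sum_mul_proportions [Nonempty ι] {a : ι → ℝ} (ha : ∀ i, 0 < a i) {f : ℝ → ℝ}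
    (hf : Measurable f) {g : (ι → ℝ) → ℝ} (hg : Measurable g) :
    ∫ x, f (∑ i, x i) * g (proportions x) ∂gammaProd a =
      (∫ t, f t ∂gammaMeasure (∑ i, a i) 1) * ∫ u, g u ∂dirichlet a := by
  have := isProbabilityMeasure_dirichlet ha
  have := isProbabilityMeasure_gammaMeasure
    (Finset.sum_pos (fun i _ ↦ ha i) Finset.univ_nonempty : 0 < ∑ i, a i) one_pos
  rw [← integral_prod_mul, ← map_sum_proportions_gammaProd ha, integral_map (by fun_prop)]
  exact ((hf.comp measurable_fst).mul (hg.comp measurable_snd)).aestronglyMeasurable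

theorem integral_gammaMeasure_add_one {a : ℝ} (ha : 0 < a) (g : ℝ → ℝ) :
    ∫ t, g t ∂gammaMeasure (a + 1) 1 = a⁻¹ * ∫ t, t * g t ∂gammaMeasure a 1 := by
  rw [gammaMeasure_add_one_eq_withDensity ha,
    integral_withDensity_eq_integral_toReal_smul (by fun_prop) (by simp), ← integral_const_mul]
  refine integral_congr_ae ?_
  filter_upwards [gammaMeasure_ae_pos a 1] with t ht
  rw [ENNReal.toReal_ofReal (by positivity), smul_eq_mul]
  ring

theorem integral_id_gammaMeasure {a : ℝ} (ha : 0 < a) : ∫ t, t ∂gammaMeasure a 1 = a := by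
  have := isProbabilityMeasure_gammaMeasure (by linarith : 0 < a + 1) one_pos
  have := integral_gammaMeasure_add_one ha (fun _ ↦ 1)
  simp only [integral_const, probReal_univ, smul_eq_mul, mul_one] at this
  field_simp at this
  exact this.symm

theorem integral_inv_gammaMeasure_add_one {a : ℝ} (ha : 0 < a) :
    ∫ t, t⁻¹ ∂gammaMeasure (a + 1) 1 = a⁻¹ := by
  have := isProbabilityMeasure_gammaMeasure ha one_pos
  rw [integral_gammaMeasure_add_one ha]
  have h : ∫ t, t * t⁻¹ ∂gammaMeasure a 1 = ∫ t, 1 ∂gammaMeasure a 1 := by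
    refine integral_congr_ae ?_
    filter_upwards [gammaMeasure_ae_pos a 1] with t ht
    exact mul_inv_cancel₀ ht.ne'
  rw [h]
  simp

theorem integral_gammaProd_add_single [DecidableEq ι] {a : ι → ℝ} (ha : ∀ i, 0 < a i) (k : ι)
    (g : (ι → ℝ) → ℝ) : ∫ x, g x ∂gammaProd (a + Pi.single k 1) =
      (a k)⁻¹ * ∫ x, x k * g x ∂gammaProd a := by
  rw [gammaProd_add_single_eq_withDensity ha,
    integral_withDensity_eq_integral_toReal_smul (by fun_prop) (by simp), ← integral_const_mul]
  refine integral_congr_ae ?_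
  filter_upwards [gammaProd_ae_pos ha] with x hx
  rw [ENNReal.toReal_ofReal (div_pos (hx k) (ha k)).le, smul_eq_mul]
  ring

theorem add_single_pos {ι : Type*} [DecidableEq ι] {a : ι → ℝ} (ha : ∀ i, 0 < a i) (k : ι) (i : ι) :
    0 < (a + Pi.single k 1 : ι → ℝ) i := by
  by_cases h : i = k
  · subst h; simp; linarith [ha i]
  · simp [h, ha i]

theorem sum_add_single [DecidableEq ι] (a : ι → ℝ) (k : ι) :
    ∑ i, (a + Pi.single k 1 : ι → ℝ) i = ∑ i, a i + 1 := by
  simp [Finset.sum_add_distrib]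

/-- Weighting a Dirichlet distribution by a coordinate raises the parameter of that coordinate
by one. -/
theorem integral_dirichlet_add_single [DecidableEq ι] {a : ι → ℝ} (ha : ∀ i, 0 < a i) (k : ι)
    {g : (ι → ℝ) → ℝ} (hg : Measurable g) :
    a k * ∫ u, g u ∂dirichlet (a + Pi.single k 1) =
      (∑ i, a i) * ∫ u, u k * g u ∂dirichlet a := by
  have : Nonempty ι := ⟨k⟩
  have hA : 0 < ∑ i, a i := Finset.sum_pos (fun i _ ↦ ha i) Finset.univ_nonempty
  rw [integral_dirichlet _ hg, integral_gammaProd_add_single ha, mul_inv_cancel_left₀ (ha k).ne',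
    ← integral_id_gammaMeasure hA,
    ← integral_sum_mul_proportions ha (f := fun t ↦ t) (by fun_prop) (by fun_prop)]
  refine integral_congr_ae ?_
  filter_upwards [gammaProd_ae_pos ha] with x hx
  have hs : 0 < ∑ i, x i := Finset.sum_pos (fun i _ ↦ hx i) Finset.univ_nonempty
  simp only [proportions, Pi.smul_apply, smul_eq_mul]
  field_simp

theorem integrable_eval_gammaProd {a : ι → ℝ} (ha : ∀ i, 0 < a i) (k : ι) :
    Integrable (fun x ↦ x k) (gammaProd a) := by
  have := fun i ↦ isProbabilityMeasure_gammaMeasure (ha i) one_pos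
  refine integrable_eval (μ := fun i ↦ gammaMeasure (a i) 1) ?_
  by_contra h
  exact (ha k).ne ((integral_undef h).symm.trans (integral_id_gammaMeasure (ha k)))

/-- Integration by parts in one coordinate, against a product of gamma measures. -/
theorem integral_gammaProd_sub_mul_add_mul_deriv {n : ℕ} {a : Fin n → ℝ} (ha : ∀ i, 0 < a i)
    (k : Fin n) {f f' : (Fin n → ℝ) → ℝ} (hf : Measurable f) (hf' : Measurable f') {C : ℝ}
    (hd : ∀ x, (∀ i, 0 < x i) →
      HasDerivAt (fun t ↦ f (Function.update x k t)) (f' x) (x k))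
    (hC : ∀ x, (∀ i, 0 < x i) → |f x| ≤ C) (hC' : ∀ x, (∀ i, 0 < x i) → |x k * f' x| ≤ C) :
    ∫ x, (a k - x k) * f x + x k * f' x ∂gammaProd a = 0 := by
  obtain _ | m := n
  · exact k.elim0
  have hp := fun i ↦ isProbabilityMeasure_gammaMeasure (ha i) one_pos
  have := isProbabilityMeasure_gammaProd ha
  have hint : Integrable (fun x : Fin (m + 1) → ℝ ↦ (a k - x k) * f x + x k * f' x)
      (gammaProd a) := by
    have hb : Integrable (fun x : Fin (m + 1) → ℝ ↦ (a k + x k) * C + C) (gammaProd a) :=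
      (((integrable_const _).add (integrable_eval_gammaProd ha k)).mul_const _).add
        (integrable_const _)
    refine hb.mono' (Measurable.aestronglyMeasurable (by fun_prop)) ?_
    filter_upwards [gammaProd_ae_pos ha] with x hx
    refine (abs_add_le _ _).trans (add_le_add ?_ (hC' x hx))
    have h1 : |a k - x k| ≤ a k + x k := by
      rw [abs_le]; constructor <;> linarith [ha k, hx k]
    rw [abs_mul]
    exact mul_le_mul h1 (hC x hx) (abs_nonneg _) (by linarith [ha k, hx k])
  have hmp := (measurePreserving_piFinSuccAbove (fun i ↦ gammaMeasure (a i) 1) k).symm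
  unfold gammaProd at hint ⊢
  rw [← hmp.integral_comp' ]
  rw [← hmp.integrable_comp_emb (MeasurableEquiv.measurableEmbedding _)] at hint
  refine (integral_prod_symm _ hint).trans ?_
  refine integral_eq_zero_of_ae ?_
  have hpos := gammaProd_ae_pos fun j ↦ ha (k.succAbove j)
  filter_upwards [hpos] with y hy
  have key := integral_gammaMeasure_sub_mul_add_mul_deriv (ha k)
    (φ := fun t ↦ f (k.insertNth t y)) (φ' := fun t ↦ f' (k.insertNth t y)) (C := C) ?_ ?_ ?_ ?_
  · refine Eq.trans (integral_congr_ae (ae_of_all _ fun t ↦ ?_)) key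
    change (a k - k.insertNth (α := fun _ ↦ ℝ) t y k) * _ +
      k.insertNth (α := fun _ ↦ ℝ) t y k * _ = _
    rw [Fin.insertNth_apply_same]
    rfl
  all_goals
    have hpos : ∀ t : ℝ, 0 < t → ∀ i, 0 < k.insertNth (α := fun _ ↦ ℝ) t y i := fun t ht i ↦ by
      refine Fin.succAboveCases k ?_ (fun j ↦ ?_) i
      · simpa using ht
      · simpa using hy j
  · intro t ht
    simpa using hd _ (hpos t ht)
  · have : Measurable fun t : ℝ ↦ (k.insertNth t y : Fin (m + 1) → ℝ) :=
      (MeasurableEquiv.piFinSuccAbove (fun _ ↦ ℝ) k).symm.measurable.comp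
        (measurable_id.prodMk measurable_const)
    exact hf'.comp this
  · exact fun t ht ↦ hC _ (hpos t ht)
  · intro t ht
    simpa using hC' _ (hpos t ht)

theorem sum_mul_proportions (lam x : ι → ℝ) :
    ∑ i, lam i * proportions x i = (∑ i, lam i * x i) / ∑ i, x i := by
  simp only [proportions, Pi.smul_apply, smul_eq_mul, div_eq_inv_mul, Finset.mul_sum]
  exact Finset.sum_congr rfl fun i _ ↦ by ring

theorem weighted_mean_mem {lam u : ι → ℝ} (hl : ∀ i, 0 ≤ lam i) (hs : 0 < ∑ i, lam i)
    (hu : (∀ i, 0 < u i) ∧ ∑ i, u i = 1) :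
    0 < ∑ i, lam i * u i ∧ ∑ i, lam i * u i ≤ ∑ i, lam i := by
  constructor
  · obtain ⟨i, _, hi⟩ := Finset.exists_lt_of_sum_lt (by simpa using hs :
      ∑ i, (0 : ℝ) < ∑ i, lam i)
    exact Finset.sum_pos' (fun j _ ↦ mul_nonneg (hl j) (hu.1 j).le)
      ⟨i, Finset.mem_univ i, mul_pos hi (hu.1 i)⟩
  · refine Finset.sum_le_sum fun i _ ↦ mul_le_of_le_one_right (hl i) ?_
    rw [← hu.2]
    exact Finset.single_le_sum (fun j _ ↦ (hu.1 j).le) (Finset.mem_univ i)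

/-- Integration by parts for functions of the weighted mean `v = ∑ i, lam i * u i` under a Dirichlet
distribution: raising the parameter of one coordinate by one costs a first-order term in
`lam k - v`. -/
theorem integral_dirichlet_by_parts {n : ℕ} {a : Fin n → ℝ} (ha : ∀ i, 0 < a i) (k : Fin n)
    {lam : Fin n → ℝ} (hl : ∀ i, 0 ≤ lam i) (hs : 0 < ∑ i, lam i) {ψ ψ' : ℝ → ℝ}
    (hψ : ∀ v, 0 < v → HasDerivAt ψ (ψ' v) v) (hm : Measurable ψ) (hm' : Measurable ψ')
    {C : ℝ} (hC : ∀ v, 0 < v → |ψ v| ≤ C) (hC' : ∀ v, 0 < v → |ψ' v| ≤ C) :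
    ∫ u, ψ (∑ i, lam i * u i) ∂dirichlet a =
      ∫ u, ψ (∑ i, lam i * u i) ∂dirichlet (a + Pi.single k 1) -
        (∑ i, a i)⁻¹ * ∫ u, ψ' (∑ i, lam i * u i) * (lam k - ∑ i, lam i * u i)
          ∂dirichlet (a + Pi.single k 1) := by
  have : Nonempty (Fin n) := ⟨k⟩
  have hA : 0 < ∑ i, a i := Finset.sum_pos (fun i _ ↦ ha i) Finset.univ_nonempty
  have := isProbabilityMeasure_gammaProd ha
  have ha' := add_single_pos ha k
  set s := ∑ i, lam i with hsdef
  have hC0 : 0 ≤ C := (abs_nonneg _).trans (hC 1 one_pos)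
  have hxs : ∀ x : Fin n → ℝ, (∀ i, 0 < x i) → 0 < ∑ i, x i := fun x hx ↦
    Finset.sum_pos (fun i _ ↦ hx i) Finset.univ_nonempty
  have hmem : ∀ x : Fin n → ℝ, (∀ i, 0 < x i) →
      0 < (∑ i, lam i * x i) / ∑ i, x i ∧ (∑ i, lam i * x i) / ∑ i, x i ≤ s := fun x hx ↦ by
    rw [← sum_mul_proportions]
    refine weighted_mean_mem hl hs ⟨fun i ↦ mul_pos (inv_pos.2 (hxs x hx)) (hx i), ?_⟩
    simp only [proportions, Pi.smul_apply, smul_eq_mul, ← Finset.mul_sum]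
    exact inv_mul_cancel₀ (hxs x hx).ne'
  set f : (Fin n → ℝ) → ℝ := fun x ↦ ψ ((∑ i, lam i * x i) / ∑ i, x i) with hf
  set g : (Fin n → ℝ) → ℝ := fun x ↦
    ψ' ((∑ i, lam i * x i) / ∑ i, x i) * (lam k - (∑ i, lam i * x i) / ∑ i, x i) with hg
  have hfm : Measurable f := by fun_prop
  have hgm : Measurable g := by fun_prop
  have hfb : ∀ x : Fin n → ℝ, (∀ i, 0 < x i) → |f x| ≤ C := fun x hx ↦ hC _ (hmem x hx).1
  have hgb : ∀ x : Fin n → ℝ, (∀ i, 0 < x i) → |g x| ≤ C * s := fun x hx ↦ by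
    have h := hmem x hx
    have hlk : lam k ≤ s := Finset.single_le_sum (fun i _ ↦ hl i) (Finset.mem_univ k)
    have h2 : |lam k - (∑ i, lam i * x i) / ∑ i, x i| ≤ s := by
      rw [abs_le]; constructor <;> linarith [hl k]
    rw [hg, abs_mul]
    exact mul_le_mul (hC' _ h.1) h2 (abs_nonneg _) hC0
  have hkb : ∀ x : Fin n → ℝ, (∀ i, 0 < x i) → |x k * ((∑ i, x i)⁻¹ * g x)| ≤ C * s := by
    intro x hx
    have h1 : |x k * (∑ i, x i)⁻¹| ≤ 1 := by
      rw [abs_of_pos (mul_pos (hx k) (inv_pos.2 (hxs x hx))), ← div_eq_mul_inv,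
        div_le_one (hxs x hx)]
      exact Finset.single_le_sum (fun j _ ↦ (hx j).le) (Finset.mem_univ k)
    rw [← mul_assoc, abs_mul]
    calc _ ≤ 1 * (C * s) := mul_le_mul h1 (hgb x hx) (abs_nonneg _) zero_le_one
      _ = _ := one_mul _
  have key := integral_gammaProd_sub_mul_add_mul_deriv ha k (f := f)
    (f' := fun x ↦ (∑ i, x i)⁻¹ * g x) (C := max C (C * s)) hfm (by fun_prop) ?_
    (fun x hx ↦ (hfb x hx).trans (le_max_left _ _))
    (fun x hx ↦ (hkb x hx).trans (le_max_right _ _))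
  · have i1 : Integrable f (gammaProd a) := by
      refine (integrable_const C).mono' hfm.aestronglyMeasurable ?_
      filter_upwards [gammaProd_ae_pos ha] with x hx using hfb x hx
    have i2 : Integrable (fun x ↦ x k * f x) (gammaProd a) := by
      refine ((integrable_eval_gammaProd ha k).mul_const C).mono'
        (Measurable.aestronglyMeasurable (by fun_prop)) ?_
      filter_upwards [gammaProd_ae_pos ha] with x hx
      rw [Real.norm_eq_abs, abs_mul, abs_of_pos (hx k)]
      exact mul_le_mul_of_nonneg_left (hfb x hx) (hx k).le
    have i3 : Integrable (fun x ↦ x k * ((∑ i, x i)⁻¹ * g x)) (gammaProd a) := by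
      refine (integrable_const (C * s)).mono' (Measurable.aestronglyMeasurable (by fun_prop)) ?_
      filter_upwards [gammaProd_ae_pos ha] with x hx using hkb x hx
    have e : ∀ x, (a k - x k) * f x + x k * ((∑ i, x i)⁻¹ * g x) =
        a k * f x - x k * f x + x k * ((∑ i, x i)⁻¹ * g x) := fun x ↦ by ring
    simp_rw [e] at key
    have i4 : Integrable (fun x ↦ a k * f x - x k * f x) (gammaProd a) := (i1.const_mul _).sub i2
    rw [integral_add i4 i3, integral_sub (i1.const_mul _) i2,
      integral_const_mul] at key
    have j2 := integral_gammaProd_add_single ha k f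
    have j3 := integral_gammaProd_add_single ha k (fun x ↦ (∑ i, x i)⁻¹ * g x)
    have j4 := integral_sum_mul_proportions ha' (f := fun t ↦ t⁻¹) (by fun_prop)
      (g := fun u ↦ ψ' (∑ i, lam i * u i) * (lam k - ∑ i, lam i * u i)) (by fun_prop)
    rw [sum_add_single, integral_inv_gammaMeasure_add_one hA] at j4
    rw [← j4]
    simp_rw [integral_dirichlet _ (f := fun u : Fin n → ℝ ↦ ψ (∑ i, lam i * u i)) (by fun_prop),
      sum_mul_proportions]
    change ∫ x, f x ∂_ = ∫ x, f x ∂_ - ∫ x, (∑ i, x i)⁻¹ * g x ∂_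
    rw [j2, j3, ← mul_sub, eq_inv_mul_iff_mul_eq₀ (ha k).ne']
    linarith
  · intro x hx
    have hu := hasDerivAt_update x k (x k)
    rw [hasDerivAt_pi] at hu
    have h1 : HasDerivAt (fun t ↦ ∑ i, lam i * Function.update x k t i) (lam k) (x k) := by
      refine (HasDerivAt.fun_sum fun i _ ↦ (hu i).const_mul (lam i)).congr_deriv ?_
      simp [Pi.single_apply]
    have h2 : HasDerivAt (fun t ↦ ∑ i, Function.update x k t i) 1 (x k) := by
      refine (HasDerivAt.fun_sum fun i _ ↦ hu i).congr_deriv ?_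
      simp
    have hsx : 0 < ∑ i, x i := hxs x hx
    have h3 := h1.fun_div h2 (by simpa using hsx.ne')
    have h4 := hψ _ (hmem x hx).1
    have h5 := HasDerivAt.comp (x k) (h₂ := ψ) (by simpa using h4) h3
    refine h5.congr_deriv ?_
    simp only [Function.update_eq_self, hg]
    field_simp

/-- The distribution function of a nonnegative combination of independent gamma variables, as an
average of gamma distribution functions over a Dirichlet distribution. -/
theorem gammaProd_real_sum_mul_lt [Nonempty ι] {a : ι → ℝ} (ha : ∀ i, 0 < a i) {lam : ι → ℝ}
    (hl : ∀ i, 0 ≤ lam i) (hs : 0 < ∑ i, lam i) (y : ℝ) :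
    (gammaProd a).real {x | ∑ i, lam i * x i < y} =
      ∫ u, (gammaMeasure (∑ i, a i) 1).real (Set.Iio (y / ∑ i, lam i * u i)) ∂dirichlet a := by
  have := isProbabilityMeasure_dirichlet ha
  have := isProbabilityMeasure_gammaMeasure
    (Finset.sum_pos (fun i _ ↦ ha i) Finset.univ_nonempty : 0 < ∑ i, a i) one_pos
  set S : Set (ℝ × (ι → ℝ)) := {p | p.1 * ∑ i, lam i * p.2 i < y} with hS
  have hSm : MeasurableSet S := measurableSet_lt (by fun_prop) (by fun_prop)
  have e1 : gammaProd a {x | ∑ i, lam i * x i < y} =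
      gammaProd a ((fun x ↦ (∑ i, x i, proportions x)) ⁻¹' S) := by
    refine measure_congr ?_
    filter_upwards [gammaProd_ae_pos ha] with x hx
    have hxs : 0 < ∑ i, x i := Finset.sum_pos (fun i _ ↦ hx i) Finset.univ_nonempty
    refine propext ?_
    change _ < _ ↔ (∑ i, x i) * ∑ i, lam i * proportions x i < y
    rw [sum_mul_proportions, mul_div_cancel₀ _ hxs.ne']
  rw [measureReal_def, e1, ← Measure.map_apply (by fun_prop) hSm,
    map_sum_proportions_gammaProd ha, Measure.prod_apply_symm hSm,
    ← integral_toReal (measurable_measure_prodMk_right hSm).aemeasurable (by simp)]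
  refine integral_congr_ae ?_
  filter_upwards [dirichlet_ae ha] with u hu
  rw [measureReal_def]
  congr 2
  ext t
  simp only [hS, Set.mem_preimage, Set.mem_ofPred_eq, Set.mem_Iio]
  exact (lt_div_iff₀ (weighted_mean_mem hl hs hu).1).symm

end

/-! ### The kernel `v ^ (-r) * exp (-z / v)` -/

/-- For shape `A`, the function `invKernel z A v` is, up to a factor depending only on `A` and `z`,
the density at `z` of `v` times a gamma variable with shape `A` and rate `1`. -/
noncomputable def invKernel (z r v : ℝ) : ℝ := v ^ (-r) * Real.exp (-(z / v))

@[fun_prop]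
theorem measurable_invKernel (z r : ℝ) : Measurable (invKernel z r) := by
  unfold invKernel; fun_prop

theorem invKernel_pos (z r : ℝ) {v : ℝ} (hv : 0 < v) : 0 < invKernel z r v := by
  unfold invKernel; positivity

theorem mul_invKernel_add_one (z r : ℝ) {v : ℝ} (hv : 0 < v) :
    v * invKernel z (r + 1) v = invKernel z r v := by
  unfold invKernel
  rw [neg_add, Real.rpow_add hv, Real.rpow_neg_one]
  field_simp

theorem hasDerivAt_invKernel (z r : ℝ) {v : ℝ} (hv : 0 < v) :
    HasDerivAt (invKernel z r) (-r * invKernel z (r + 1) v + z * invKernel z (r + 2) v) v := by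
  have h1 := Real.hasDerivAt_rpow_const (p := -r) (Or.inl hv.ne')
  have h2 := (((hasDerivAt_const v z).fun_div (hasDerivAt_id' v) hv.ne').fun_neg).exp
  refine (h1.fun_mul h2).congr_deriv ?_
  unfold invKernel
  rw [Real.rpow_sub_one hv.ne', neg_add, neg_add, Real.rpow_add hv, Real.rpow_add hv,
    Real.rpow_neg_one, Real.rpow_neg hv.le 2, Real.rpow_two]
  field_simp
  ring

/-- Writing `y = 1 / v`, the bound says `y ^ r * exp (-z * y) ≤ (r / z) ^ r`. -/
theorem invKernel_le {z₀ z r v : ℝ} (hz₀ : 0 < z₀) (hz : z₀ ≤ z) (hr : 0 < r) (hv : 0 < v) :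
    invKernel z r v ≤ (r / z₀) ^ r := by
  unfold invKernel
  have h1 : z₀ / (v * r) ≤ Real.exp (z₀ / (v * r)) := by
    linarith [Real.add_one_le_exp (z₀ / (v * r))]
  have h2 : (z₀ / (v * r)) ^ r ≤ Real.exp (z₀ / v) := by
    calc (z₀ / (v * r)) ^ r ≤ Real.exp (z₀ / (v * r)) ^ r :=
          Real.rpow_le_rpow (by positivity) h1 hr.le
      _ = Real.exp (z₀ / v) := by rw [← Real.exp_mul]; congr 1; field_simp
  have h3 : v ^ (-r) = (r / z₀) ^ r * (z₀ / (v * r)) ^ r := by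
    rw [← Real.mul_rpow (by positivity) (by positivity), Real.rpow_neg hv.le,
      ← Real.inv_rpow hv.le]
    congr 1
    field_simp
  have h4 : Real.exp (-(z / v)) ≤ Real.exp (-(z₀ / v)) :=
    Real.exp_le_exp.2 (neg_le_neg (by gcongr))
  rw [h3]
  calc (r / z₀) ^ r * (z₀ / (v * r)) ^ r * Real.exp (-(z / v))
      ≤ (r / z₀) ^ r * Real.exp (z₀ / v) * Real.exp (-(z₀ / v)) := by gcongr
    _ = (r / z₀) ^ r := by rw [mul_assoc, ← Real.exp_add]; simp

theorem exists_abs_invKernel_le {z : ℝ} (hz : 0 < z) {r : ℝ} (hr : 0 < r) :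
    ∃ C, ∀ v, 0 < v → |invKernel z r v| ≤ C :=
  ⟨_, fun v hv ↦ by
    rw [abs_of_pos (invKernel_pos z r hv)]; exact invKernel_le hz le_rfl hr hv⟩

theorem exists_abs_deriv_invKernel_le {z : ℝ} (hz : 0 < z) {r : ℝ} (hr : 0 < r) :
    ∃ C, ∀ v, 0 < v → |-r * invKernel z (r + 1) v + z * invKernel z (r + 2) v| ≤ C := by
  obtain ⟨C₁, h₁⟩ := exists_abs_invKernel_le hz (by linarith : 0 < r + 1)
  obtain ⟨C₂, h₂⟩ := exists_abs_invKernel_le hz (by linarith : 0 < r + 2)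
  refine ⟨r * C₁ + z * C₂, fun v hv ↦ (abs_add_le _ _).trans ?_⟩
  rw [abs_mul, abs_mul, abs_neg, abs_of_pos hr, abs_of_pos hz]
  exact add_le_add (mul_le_mul_of_nonneg_left (h₁ v hv) hr.le)
    (mul_le_mul_of_nonneg_left (h₂ v hv) hz.le)

/-! ### Functions of a weighted mean under a Dirichlet distribution -/

section

variable {ι : Type*} [Fintype ι] {a lam : ι → ℝ}

/-- The mean of `invKernel z r` at the weighted mean `∑ i, lam i * u i` under the Dirichlet
distribution with parameters `a i`. When `r = ∑ i, a i` this is, up to a factor depending only on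
`z` and `r`, the density at `z` of the combination `∑ i, lam i * G i` of independent gamma
variables with shapes `a i`. -/
noncomputable def kernelMean (a lam : ι → ℝ) (z r : ℝ) : ℝ :=
  ∫ u, invKernel z r (∑ i, lam i * u i) ∂dirichlet a

theorem mul_kernelMean_add_single [DecidableEq ι] (ha : ∀ i, 0 < a i) (k : ι) (z r : ℝ) :
    a k * kernelMean (a + Pi.single k 1) lam z r =
      (∑ i, a i) * ∫ u, u k * invKernel z r (∑ i, lam i * u i) ∂dirichlet a :=
  integral_dirichlet_add_single ha k (by fun_prop)

variable [Nonempty ι]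

theorem integrable_weighted_mean (ha : ∀ i, 0 < a i) (hl : ∀ i, 0 ≤ lam i)
    (hs : 0 < ∑ i, lam i) {ψ : ℝ → ℝ} (hm : Measurable ψ) {C : ℝ} (hC : ∀ v, 0 < v → |ψ v| ≤ C) :
    Integrable (fun u ↦ ψ (∑ i, lam i * u i)) (dirichlet a) := by
  have := isProbabilityMeasure_dirichlet ha
  refine (integrable_const C).mono' (Measurable.aestronglyMeasurable (by fun_prop)) ?_
  filter_upwards [dirichlet_ae ha] with u hu using hC _ (weighted_mean_mem hl hs hu).1

theorem integrable_eval_mul_dirichlet (ha : ∀ i, 0 < a i) {f : (ι → ℝ) → ℝ}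
    (hf : Integrable f (dirichlet a)) (k : ι) :
    Integrable (fun u ↦ u k * f u) (dirichlet a) := by
  refine hf.bdd_mul (c := 1) (Measurable.aestronglyMeasurable (by fun_prop)) ?_
  filter_upwards [dirichlet_ae ha] with u hu
  rw [Real.norm_eq_abs, abs_of_pos (hu.1 k), ← hu.2]
  exact Finset.single_le_sum (fun j _ ↦ (hu.1 j).le) (Finset.mem_univ k)

theorem hasDerivAt_integral_weighted_mean (ha : ∀ i, 0 < a i) {w : ι → ℝ} {t₀ : ℝ}
    (hL : ∀ᶠ t in nhds t₀, (∀ i, 0 ≤ lam i + t * w i) ∧ 0 < ∑ i, (lam i + t * w i))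
    {ψ ψ' : ℝ → ℝ} (hψ : ∀ v, 0 < v → HasDerivAt ψ (ψ' v) v) (hm : Measurable ψ)
    (hm' : Measurable ψ') {C : ℝ} (hC : ∀ v, 0 < v → |ψ v| ≤ C)
    (hC' : ∀ v, 0 < v → |ψ' v| ≤ C) :
    HasDerivAt (fun t ↦ ∫ u, ψ (∑ i, (lam i + t * w i) * u i) ∂dirichlet a)
      (∑ k, w k * ∫ u, u k * ψ' (∑ i, (lam i + t₀ * w i) * u i) ∂dirichlet a) t₀ := by
  have := isProbabilityMeasure_dirichlet ha
  have hC0 : 0 ≤ C := (abs_nonneg _).trans (hC 1 one_pos)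
  have h0 := hL.self_of_nhds
  have key := (hasDerivAt_integral_of_dominated_loc_of_deriv_le (μ := dirichlet a)
    (F := fun t u ↦ ψ (∑ i, (lam i + t * w i) * u i))
    (F' := fun t u ↦ ψ' (∑ i, (lam i + t * w i) * u i) * ∑ k, w k * u k)
    (bound := fun _ ↦ C * ∑ k, |w k|) (x₀ := t₀) hL
    (Filter.Eventually.of_forall fun t ↦ Measurable.aestronglyMeasurable (by fun_prop))
    (integrable_weighted_mean ha h0.1 h0.2 hm hC)
    (Measurable.aestronglyMeasurable (by fun_prop)) ?_ (integrable_const _) ?_).2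
  · refine key.congr_deriv ?_
    simp_rw [← integral_const_mul]
    rw [← integral_finsetSum _ fun k _ ↦ (integrable_eval_mul_dirichlet ha
      (integrable_weighted_mean ha h0.1 h0.2 hm' hC') k).const_mul _]
    refine integral_congr_ae (ae_of_all _ fun u ↦ ?_)
    simp only [Finset.mul_sum]
    exact Finset.sum_congr rfl fun k _ ↦ by ring
  · filter_upwards [dirichlet_ae ha] with u hu t ht
    rw [Real.norm_eq_abs, abs_mul]
    refine mul_le_mul (hC' _ (weighted_mean_mem ht.1 ht.2 hu).1) ?_ (abs_nonneg _) hC0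
    refine (Finset.abs_sum_le_sum_abs _ _).trans (Finset.sum_le_sum fun k _ ↦ ?_)
    rw [abs_mul, abs_of_pos (hu.1 k)]
    refine mul_le_of_le_one_right (abs_nonneg _) ?_
    rw [← hu.2]
    exact Finset.single_le_sum (fun j _ ↦ (hu.1 j).le) (Finset.mem_univ k)
  · filter_upwards [dirichlet_ae ha] with u hu t ht
    have h1 : HasDerivAt (fun t ↦ ∑ i, (lam i + t * w i) * u i) (∑ k, w k * u k) t := by
      refine (HasDerivAt.fun_sum fun i _ ↦
        (((hasDerivAt_id' t).mul_const (w i)).const_add (lam i)).mul_const (u i)).congr_deriv ?_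
      simp
    exact HasDerivAt.comp t (h₂ := ψ) (hψ _ (weighted_mean_mem ht.1 ht.2 hu).1) h1

theorem integrable_invKernel (ha : ∀ i, 0 < a i) (hl : ∀ i, 0 ≤ lam i) (hs : 0 < ∑ i, lam i)
    {z : ℝ} (hz : 0 < z) {r : ℝ} (hr : 0 < r) :
    Integrable (fun u ↦ invKernel z r (∑ i, lam i * u i)) (dirichlet a) := by
  obtain ⟨C, hC⟩ := exists_abs_invKernel_le hz hr
  exact integrable_weighted_mean ha hl hs (by fun_prop) hC

theorem kernelMean_pos (ha : ∀ i, 0 < a i) (hl : ∀ i, 0 ≤ lam i) (hs : 0 < ∑ i, lam i)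
    {z : ℝ} (hz : 0 < z) {r : ℝ} (hr : 0 < r) : 0 < kernelMean a lam z r := by
  have := isProbabilityMeasure_dirichlet ha
  have hp : ∀ᵐ u ∂dirichlet a, 0 < invKernel z r (∑ i, lam i * u i) := by
    filter_upwards [dirichlet_ae ha] with u hu
    exact invKernel_pos z r (weighted_mean_mem hl hs hu).1
  refine lt_of_le_of_ne (integral_nonneg_of_ae (hp.mono fun u h ↦ h.le)) fun h ↦ ?_
  have h0 := (integral_eq_zero_iff_of_nonneg_ae (hp.mono fun u h ↦ h.le)
    (integrable_invKernel ha hl hs hz hr)).1 h.symm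
  obtain ⟨u, h1, h2⟩ := (hp.and h0).exists
  exact h1.ne' h2

theorem continuousOn_kernelMean (ha : ∀ i, 0 < a i) {z₀ : ℝ} (hz₀ : 0 < z₀) {r : ℝ} (hr : 0 < r) :
    ContinuousOn (fun p : (ι → ℝ) × ℝ ↦ kernelMean a p.1 p.2 r)
      {p | ((∀ i, 0 ≤ p.1 i) ∧ 0 < ∑ i, p.1 i) ∧ z₀ ≤ p.2} := by
  have := isProbabilityMeasure_dirichlet ha
  unfold kernelMean
  refine continuousOn_of_dominated (bound := fun _ ↦ (r / z₀) ^ r)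
    (fun p _ ↦ Measurable.aestronglyMeasurable (by fun_prop)) (fun p hp ↦ ?_)
    (integrable_const _) ?_
  · filter_upwards [dirichlet_ae ha] with u hu
    have hv := (weighted_mean_mem hp.1.1 hp.1.2 hu).1
    rw [Real.norm_eq_abs, abs_of_pos (invKernel_pos _ _ hv)]
    exact invKernel_le hz₀ hp.2 hr hv
  · filter_upwards [dirichlet_ae ha] with u hu p hp
    have hv := (weighted_mean_mem hp.1.1 hp.1.2 hu).1
    have hc : ContinuousAt (fun p : (ι → ℝ) × ℝ ↦ ∑ i, p.1 i * u i) p := by fun_prop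
    unfold invKernel
    exact ((hc.rpow_const (Or.inl hv.ne')).mul
      ((continuousAt_snd.div hc hv.ne').neg.rexp)).continuousWithinAt

variable [DecidableEq ι]

theorem sum_mul_kernelMean_add_single (ha : ∀ i, 0 < a i) (hl : ∀ i, 0 ≤ lam i)
    (hs : 0 < ∑ i, lam i) {z : ℝ} (hz : 0 < z) {r : ℝ} (hr : 0 < r) :
    ∑ k, a k * kernelMean (a + Pi.single k 1) lam z r = (∑ i, a i) * kernelMean a lam z r := by
  have hi := integrable_invKernel ha hl hs hz hr
  simp_rw [mul_kernelMean_add_single ha, ← Finset.mul_sum]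
  congr 1
  rw [← integral_finsetSum _ fun k _ ↦ integrable_eval_mul_dirichlet ha hi k]
  refine integral_congr_ae ?_
  filter_upwards [dirichlet_ae ha] with u hu
  rw [← Finset.sum_mul, hu.2, one_mul]

theorem sum_mul_mul_kernelMean_add_single (ha : ∀ i, 0 < a i) (hl : ∀ i, 0 ≤ lam i)
    (hs : 0 < ∑ i, lam i) {z : ℝ} (hz : 0 < z) {r : ℝ} (hr : 0 < r) :
    ∑ k, lam k * (a k * kernelMean (a + Pi.single k 1) lam z (r + 1)) =
      (∑ i, a i) * kernelMean a lam z r := by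
  have hi := integrable_invKernel ha hl hs hz (by linarith : 0 < r + 1)
  simp_rw [mul_kernelMean_add_single ha, mul_left_comm (lam _), ← Finset.mul_sum,
    ← integral_const_mul]
  congr 1
  rw [← integral_finsetSum _ fun k _ ↦ (integrable_eval_mul_dirichlet ha hi k).const_mul _]
  refine integral_congr_ae ?_
  filter_upwards [dirichlet_ae ha] with u hu
  rw [← mul_invKernel_add_one z r (weighted_mean_mem hl hs hu).1, Finset.sum_mul]
  exact Finset.sum_congr rfl fun k _ ↦ by ring

theorem hasDerivAt_kernelMean (ha : ∀ i, 0 < a i) {w : ι → ℝ} {t₀ : ℝ}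
    (hL : ∀ᶠ t in nhds t₀, (∀ i, 0 ≤ lam i + t * w i) ∧ 0 < ∑ i, (lam i + t * w i))
    {z : ℝ} (hz : 0 < z) {r : ℝ} (hr : 0 < r) :
    HasDerivAt (fun t ↦ kernelMean a (fun i ↦ lam i + t * w i) z r)
      (∑ k, w k * (a k / (∑ i, a i) *
        (-r * kernelMean (a + Pi.single k 1) (fun i ↦ lam i + t₀ * w i) z (r + 1) +
          z * kernelMean (a + Pi.single k 1) (fun i ↦ lam i + t₀ * w i) z (r + 2)))) t₀ := by
  have hA : 0 < ∑ i, a i := Finset.sum_pos (fun i _ ↦ ha i) Finset.univ_nonempty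
  obtain ⟨C₁, h₁⟩ := exists_abs_invKernel_le hz hr
  obtain ⟨C₂, h₂⟩ := exists_abs_deriv_invKernel_le hz hr
  have h0 := hL.self_of_nhds
  refine (hasDerivAt_integral_weighted_mean ha hL (fun v hv ↦ hasDerivAt_invKernel z r hv)
    (by fun_prop) (by fun_prop) (fun v hv ↦ (h₁ v hv).trans (le_max_left C₁ C₂))
    (fun v hv ↦ (h₂ v hv).trans (le_max_right C₁ C₂))).congr_deriv ?_
  refine Finset.sum_congr rfl fun k _ ↦ ?_
  congr 1
  have i1 := integrable_eval_mul_dirichlet ha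
    (integrable_invKernel ha h0.1 h0.2 hz (by linarith : 0 < r + 1)) k
  have i2 := integrable_eval_mul_dirichlet ha
    (integrable_invKernel ha h0.1 h0.2 hz (by linarith : 0 < r + 2)) k
  have e1 := mul_kernelMean_add_single ha k z (r + 1) (lam := fun i ↦ lam i + t₀ * w i)
  have e2 := mul_kernelMean_add_single ha k z (r + 2) (lam := fun i ↦ lam i + t₀ * w i)
  have e3 : ∫ u, u k * (-r * invKernel z (r + 1) (∑ i, (lam i + t₀ * w i) * u i) +
      z * invKernel z (r + 2) (∑ i, (lam i + t₀ * w i) * u i)) ∂dirichlet a =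
      -r * ∫ u, u k * invKernel z (r + 1) (∑ i, (lam i + t₀ * w i) * u i) ∂dirichlet a +
      z * ∫ u, u k * invKernel z (r + 2) (∑ i, (lam i + t₀ * w i) * u i) ∂dirichlet a := by
    rw [← integral_const_mul, ← integral_const_mul,
      ← integral_add (i1.const_mul _) (i2.const_mul _)]
    exact integral_congr_ae (ae_of_all _ fun u ↦ by ring)
  rw [e3]
  field_simp
  linear_combination r * e1 - z * e2

end

theorem kernelMean_by_parts {n : ℕ} {a lam : Fin n → ℝ} (ha : ∀ i, 0 < a i) (hl : ∀ i, 0 ≤ lam i)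
    (hs : 0 < ∑ i, lam i) (k : Fin n) {z : ℝ} (hz : 0 < z) {r : ℝ} (hr : 0 < r) :
    (∑ i, a i) * kernelMean a lam z r =
      (∑ i, a i - r) * kernelMean (a + Pi.single k 1) lam z r +
        z * kernelMean (a + Pi.single k 1) lam z (r + 1) +
        lam k * (r * kernelMean (a + Pi.single k 1) lam z (r + 1) -
          z * kernelMean (a + Pi.single k 1) lam z (r + 2)) := by
  have : Nonempty (Fin n) := ⟨k⟩
  have hA : 0 < ∑ i, a i := Finset.sum_pos (fun i _ ↦ ha i) Finset.univ_nonempty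
  have ha' := add_single_pos ha k
  obtain ⟨C₁, h₁⟩ := exists_abs_invKernel_le hz hr
  obtain ⟨C₂, h₂⟩ := exists_abs_deriv_invKernel_le hz hr
  have key := integral_dirichlet_by_parts ha k hl hs (fun v hv ↦ hasDerivAt_invKernel z r hv)
    (by fun_prop) (by fun_prop) (fun v hv ↦ (h₁ v hv).trans (le_max_left C₁ C₂))
    (fun v hv ↦ (h₂ v hv).trans (le_max_right C₁ C₂))
  have i0 := integrable_invKernel ha' hl hs hz hr
  have i1 := integrable_invKernel ha' hl hs hz (by linarith : 0 < r + 1)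
  have i2 := integrable_invKernel ha' hl hs hz (by linarith : 0 < r + 2)
  have e : ∫ u, (-r * invKernel z (r + 1) (∑ i, lam i * u i) +
      z * invKernel z (r + 2) (∑ i, lam i * u i)) * (lam k - ∑ i, lam i * u i)
        ∂dirichlet (a + Pi.single k 1) =
      r * kernelMean (a + Pi.single k 1) lam z r +
      (-(lam k * r) - z) * kernelMean (a + Pi.single k 1) lam z (r + 1) +
      lam k * z * kernelMean (a + Pi.single k 1) lam z (r + 2) := by
    unfold kernelMean
    have i01 := (i0.const_mul r).fun_add (i1.const_mul (-(lam k * r) - z))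
    rw [← integral_const_mul, ← integral_const_mul, ← integral_const_mul,
      ← integral_add (i0.const_mul _) (i1.const_mul _), ← integral_add i01 (i2.const_mul _)]
    refine integral_congr_ae ?_
    filter_upwards [dirichlet_ae ha'] with u hu
    have hv := (weighted_mean_mem hl hs hu).1
    have e1 := mul_invKernel_add_one z r hv
    have e2 := mul_invKernel_add_one z (r + 1) hv
    rw [add_assoc, one_add_one_eq_two] at e2
    linear_combination r * e1 - z * e2
  rw [e] at key
  change kernelMean a lam z r = kernelMean _ lam z r - _ at key
  rw [key]
  field_simp
  ring

/-! ### The derivative of the density of a combination of gamma variables -/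

section

variable {n : ℕ} {b lam : Fin n → ℝ}

/-- Up to a positive factor depending only on `z` and the `b i`, the derivative at `z` of the
density of the combination `∑ i, lam i * G i` of independent gamma variables with shapes `b i`. -/
noncomputable def densityDeriv (b lam : Fin n → ℝ) (z : ℝ) : ℝ :=
  (∑ i, b i - 1) * kernelMean b lam z (∑ i, b i) - z * kernelMean b lam z (∑ i, b i + 1)

/-- With `f` the density for the shapes `b` and `g` the one for the shapes `b + Pi.single k 1`, this
is the equation `f = g + lam k * g'`. -/
theorem sum_mul_kernelMean_eq (hb : ∀ i, 0 < b i) (hl : ∀ i, 0 ≤ lam i) (hs : 0 < ∑ i, lam i)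
    (k : Fin n) {z : ℝ} (hz : 0 < z) :
    (∑ i, b i) * kernelMean b lam z (∑ i, b i) =
      z * kernelMean (b + Pi.single k 1) lam z (∑ i, b i + 1) +
        lam k * densityDeriv (b + Pi.single k 1) lam z := by
  have : Nonempty (Fin n) := ⟨k⟩
  have hB : 0 < ∑ i, b i := Finset.sum_pos (fun i _ ↦ hb i) Finset.univ_nonempty
  rw [kernelMean_by_parts hb hl hs k hz hB, densityDeriv, sum_add_single, add_assoc _ (1 : ℝ) 1,
    one_add_one_eq_two]
  ring

/-- By the Cauchy-Schwarz inequality, if `f' ≤ 0` at `z` then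
`(b k - 1) / b k * f ≤ g` at `z`, where `f` and `g` are the densities for the shapes `b` and
`b + Pi.single k 1`. -/
theorem sub_one_mul_kernelMean_le (hb : ∀ i, 0 < b i) (k : Fin n) (hk : 1 < b k)
    (hl : ∀ i, 0 ≤ lam i) (hs : 0 < ∑ i, lam i) {z : ℝ} (hz : 0 < z)
    (hQ : densityDeriv b lam z ≤ 0) :
    (b k - 1) * ((∑ i, b i) * kernelMean b lam z (∑ i, b i)) ≤
      z * (b k * kernelMean (b + Pi.single k 1) lam z (∑ i, b i + 1)) := by
  have : Nonempty (Fin n) := ⟨k⟩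
  obtain ⟨c, rfl⟩ : ∃ c, b = c + Pi.single k 1 := ⟨b - Pi.single k 1, by simp⟩
  have hck : 0 < c k := by simpa using hk
  have hc : ∀ i, 0 < c i := fun i ↦ by
    by_cases h : i = k
    · exact h ▸ hck
    · simpa [h] using hb i
  have hC : 0 < ∑ i, c i := Finset.sum_pos (fun i _ ↦ hc i) Finset.univ_nonempty
  have h1 := sum_mul_kernelMean_eq hc hl hs k hz
  have h2 := mul_kernelMean_add_single hc k z (∑ i, c i + 1) (lam := lam)
  have h3 := mul_kernelMean_add_single hb k z (∑ i, c i + 1 + 1) (lam := lam)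
  have h4 := integral_dirichlet_add_single hc k
    (g := fun u ↦ u k * invKernel z (∑ i, c i + 1 + 1) (∑ i, lam i * u i)) (by fun_prop)
  rw [sum_add_single] at h3 ⊢
  have i0 := integrable_invKernel hc hl hs hz hC
  have i1 := integrable_eval_mul_dirichlet hc
    (integrable_invKernel hc hl hs hz (by linarith : 0 < ∑ i, c i + 1)) k
  have i2 := integrable_eval_mul_dirichlet hc (integrable_eval_mul_dirichlet hc
    (integrable_invKernel hc hl hs hz (by linarith : 0 < ∑ i, c i + 1 + 1)) k) k
  have p0 : 0 < kernelMean c lam z (∑ i, c i) := kernelMean_pos hc hl hs hz hC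
  have p1 : 0 < kernelMean (c + Pi.single k 1) lam z (∑ i, c i + 1) :=
    kernelMean_pos hb hl hs hz (by linarith)
  simp only [Pi.add_apply, Pi.single_eq_same] at h3 ⊢
  set C := ∑ i, c i
  set X := kernelMean c lam z C with hX
  set Y := ∫ u, u k * invKernel z (C + 1) (∑ i, lam i * u i) ∂dirichlet c
  set W := ∫ u, u k * (u k * invKernel z (C + 1 + 1) (∑ i, lam i * u i)) ∂dirichlet c
  set N := kernelMean (c + Pi.single k 1) lam z (C + 1)
  have cs : Y ^ 2 ≤ X * W := by
    have hq : 0 ≤ (Y / X) ^ 2 * X - 2 * (Y / X) * Y + W := by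
      have e : (Y / X) ^ 2 * X - 2 * (Y / X) * Y + W =
          ∫ u, (Y / X) ^ 2 * invKernel z C (∑ i, lam i * u i) -
            2 * (Y / X) * (u k * invKernel z (C + 1) (∑ i, lam i * u i)) +
            u k * (u k * invKernel z (C + 1 + 1) (∑ i, lam i * u i)) ∂dirichlet c := by
        have i01 : Integrable (fun u ↦ (Y / X) ^ 2 * invKernel z C (∑ i, lam i * u i) -
            2 * (Y / X) * (u k * invKernel z (C + 1) (∑ i, lam i * u i))) (dirichlet c) :=
          (i0.const_mul _).sub (i1.const_mul _)
        rw [integral_add i01 i2, integral_sub (i0.const_mul _) (i1.const_mul _),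
          integral_const_mul, integral_const_mul]
        rfl
      rw [e]
      refine integral_nonneg_of_ae ?_
      filter_upwards [dirichlet_ae hc] with u hu
      have hv := (weighted_mean_mem hl hs hu).1
      rw [← mul_invKernel_add_one z C hv, ← mul_invKernel_add_one z (C + 1) hv]
      have := (invKernel_pos z (C + 1 + 1) hv).le
      calc (0 : ℝ) ≤ invKernel z (C + 1 + 1) (∑ i, lam i * u i) *
            (Y / X * (∑ i, lam i * u i) - u k) ^ 2 := by positivity
        _ = _ := by ring
    have : (Y / X) ^ 2 * X - 2 * (Y / X) * Y + W = W - Y ^ 2 / X := by field_simp; ring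
    rw [this, sub_nonneg, div_le_iff₀ p0] at hq
    linarith
  have hCX : C * X ≤ z * N := by
    rw [h1]
    linarith [mul_nonpos_of_nonneg_of_nonpos (hl k) hQ]
  have hY : Y = c k * N / C := by field_simp; linarith
  have hW : (c k + 1) * kernelMean (c + Pi.single k 1 + Pi.single k 1) lam z (C + 1 + 1) =
      (C + 1) * (C * W / c k) := by
    rw [h3]
    congr 1
    field_simp
    linarith
  rw [hW, add_sub_cancel_right]
  rw [hY] at cs
  have h5 : (c k * N) ^ 2 ≤ N * (z * C * W) := by
    have h6 : (c k * N / C) ^ 2 = (c k * N) ^ 2 / C ^ 2 := by rw [div_pow]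
    rw [h6, div_le_iff₀ (by positivity)] at cs
    have hW0 : 0 ≤ W := by
      refine integral_nonneg_of_ae ?_
      filter_upwards [dirichlet_ae hc] with u hu
      have hv := (weighted_mean_mem hl hs hu).1
      have := (invKernel_pos z (C + 1 + 1) hv).le
      have := (hu.1 k).le
      simp only [Pi.zero_apply]
      positivity
    calc _ ≤ X * W * C ^ 2 := cs
      _ = C * X * (W * C) := by ring
      _ ≤ z * N * (W * C) := by gcongr
      _ = _ := by ring
  have h7 : c k ^ 2 * N ≤ z * C * W := by
    refine le_of_mul_le_mul_left ?_ p1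
    calc _ = (c k * N) ^ 2 := by ring
      _ ≤ _ := h5
  calc c k * ((C + 1) * N) = (C + 1) * (c k ^ 2 * N) / c k := by field_simp
    _ ≤ (C + 1) * (z * C * W) / c k := by gcongr
    _ = _ := by ring

/-- The density increases up to the corresponding combination of the modes `b k - 1`. -/
theorem densityDeriv_pos (hb : ∀ i, 1 < b i) (hl : ∀ i, 0 ≤ lam i) (hs : 0 < ∑ i, lam i)
    {z : ℝ} (hz : 0 < z) (h : z < ∑ k, lam k * (b k - 1)) : 0 < densityDeriv b lam z := by
  have hne : Nonempty (Fin n) := by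
    by_contra hn
    rw [not_nonempty_iff] at hn
    simp at hs
  by_contra! hQ
  have hb0 : ∀ i, 0 < b i := fun i ↦ one_pos.trans (hb i)
  have hB : 0 < ∑ i, b i := Finset.sum_pos (fun i _ ↦ hb0 i) Finset.univ_nonempty
  have hp := mul_pos hB (kernelMean_pos hb0 hl hs hz hB)
  have h1 : ∑ k, lam k * ((b k - 1) * ((∑ i, b i) * kernelMean b lam z (∑ i, b i))) ≤
      ∑ k, lam k * (z * (b k * kernelMean (b + Pi.single k 1) lam z (∑ i, b i + 1))) :=
    Finset.sum_le_sum fun k _ ↦ mul_le_mul_of_nonneg_left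
      (sub_one_mul_kernelMean_le hb0 k (hb k) hl hs hz hQ) (hl k)
  have h2 := sum_mul_mul_kernelMean_add_single hb0 hl hs hz hB
  simp_rw [mul_left_comm _ z, ← mul_assoc (lam _), ← Finset.mul_sum] at h1
  simp_rw [← mul_assoc (lam _)] at h2
  rw [h2, ← Finset.sum_mul] at h1
  exact absurd (le_of_mul_le_mul_right h1 hp) (not_le.2 h)

/-- Up to a negative factor depending only on `z` and the `b i`, the second derivative at `z` of the
density for the shapes `b + Pi.single k 1`. -/
noncomputable def densityDerivTwo (b lam : Fin n → ℝ) (z : ℝ) (k : Fin n) : ℝ :=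
  -((∑ i, b i) * (∑ i, b i - 1) * kernelMean (b + Pi.single k 1) lam z (∑ i, b i + 1)) +
    2 * (∑ i, b i) * z * kernelMean (b + Pi.single k 1) lam z (∑ i, b i + 2) -
    z ^ 2 * kernelMean (b + Pi.single k 1) lam z (∑ i, b i + 3)

theorem hasDerivAt_densityDeriv [Nonempty (Fin n)] (hb : ∀ i, 0 < b i) {w : Fin n → ℝ} {t₀ : ℝ}
    (hL : ∀ᶠ t in nhds t₀, (∀ i, 0 ≤ lam i + t * w i) ∧ 0 < ∑ i, (lam i + t * w i))
    {z : ℝ} (hz : 0 < z) :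
    HasDerivAt (fun t ↦ densityDeriv b (fun i ↦ lam i + t * w i) z)
      (∑ k, w k * (b k / (∑ i, b i) *
        densityDerivTwo b (fun i ↦ lam i + t₀ * w i) z k)) t₀ := by
  have hB : 0 < ∑ i, b i := Finset.sum_pos (fun i _ ↦ hb i) Finset.univ_nonempty
  have h1 := hasDerivAt_kernelMean hb hL hz hB
  have h2 := hasDerivAt_kernelMean hb hL hz (by linarith : 0 < ∑ i, b i + 1)
  refine ((h1.const_mul (∑ i, b i - 1)).fun_sub (h2.const_mul z)).congr_deriv ?_
  simp_rw [Finset.mul_sum]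
  rw [← Finset.sum_sub_distrib]
  refine Finset.sum_congr rfl fun k _ ↦ ?_
  rw [densityDerivTwo, add_assoc _ (1 : ℝ) 1, add_assoc _ (1 : ℝ) 2, one_add_one_eq_two,
    show (1 : ℝ) + 2 = 3 by norm_num]
  ring

/-- At a critical point, the equation `f = g + lam k * g'` and its derivative
`f' = g' + lam k * g''` give `lam k ^ 2 * g''` in terms of the densities `f` and `g`. -/
theorem sq_mul_densityDerivTwo (hb : ∀ i, 0 < b i) (hl : ∀ i, 0 ≤ lam i) (hs : 0 < ∑ i, lam i)
    (k : Fin n) {z : ℝ} (hz : 0 < z) (hQ : densityDeriv b lam z = 0) :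
    lam k ^ 2 * densityDerivTwo b lam z k =
      z * ((∑ i, b i) * kernelMean b lam z (∑ i, b i) -
        z * kernelMean (b + Pi.single k 1) lam z (∑ i, b i + 1)) := by
  have : Nonempty (Fin n) := ⟨k⟩
  have hB : 0 < ∑ i, b i := Finset.sum_pos (fun i _ ↦ hb i) Finset.univ_nonempty
  have h1 := kernelMean_by_parts hb hl hs k hz hB
  have h2 := kernelMean_by_parts hb hl hs k hz (by linarith : 0 < ∑ i, b i + 1)
  rw [add_assoc _ (1 : ℝ) 1, add_assoc _ (1 : ℝ) 2, one_add_one_eq_two,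
    show (1 : ℝ) + 2 = 3 by norm_num] at h2
  rw [densityDeriv] at hQ
  rw [densityDerivTwo]
  set B := ∑ i, b i
  linear_combination (-(lam k) * B) * hQ + (lam k * (B - 1) - z) * h1 - lam k * z * h2

theorem kernelMean_le_mul (hb : ∀ i, 0 < b i) (hl : ∀ i, 0 ≤ lam i) (hs : 0 < ∑ i, lam i)
    {z : ℝ} (hz : 0 < z) {r : ℝ} (hr : 0 < r) :
    kernelMean b lam z r ≤ (∑ i, lam i) * kernelMean b lam z (r + 1) := by
  have hne : Nonempty (Fin n) := by
    by_contra hn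
    rw [not_nonempty_iff] at hn
    simp at hs
  unfold kernelMean
  rw [← integral_const_mul]
  refine integral_mono_ae (integrable_invKernel hb hl hs hz hr)
    ((integrable_invKernel hb hl hs hz (by linarith)).const_mul _) ?_
  filter_upwards [dirichlet_ae hb] with u hu
  have hv := weighted_mean_mem hl hs hu
  rw [← mul_invKernel_add_one z r hv.1]
  exact mul_le_mul_of_nonneg_right hv.2 (invKernel_pos _ _ hv.1).le

theorem le_of_densityDeriv_nonneg (hb : ∀ i, 0 < b i) (hB : 1 ≤ ∑ i, b i) (hl : ∀ i, 0 ≤ lam i)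
    (hs : 0 < ∑ i, lam i) {z : ℝ} (hz : 0 < z) (hQ : 0 ≤ densityDeriv b lam z) :
    z ≤ (∑ i, b i - 1) * ∑ i, lam i := by
  have hne : Nonempty (Fin n) := by
    by_contra hn
    rw [not_nonempty_iff] at hn
    simp at hs
  have hp := kernelMean_pos hb hl hs hz (by linarith : 0 < ∑ i, b i + 1)
  have h1 := mul_le_mul_of_nonneg_left (kernelMean_le_mul hb hl hs hz
    (by linarith : 0 < ∑ i, b i)) (by linarith : 0 ≤ ∑ i, b i - 1)
  refine le_of_mul_le_mul_right ?_ hp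
  rw [densityDeriv] at hQ
  linarith

/-- If every point `lam` of the simplex `∑ i, lam i = s` at which the derivative of the density
vanishes at `z` and is stationary in `lam` has `z < z₀`, then the density decreases beyond `z₀` for
all `lam` in the simplex. The stationarity determines `z` as
`∑ i, lam i * b i - (∑ i, lam i ^ 3) / ∑ i, lam i ^ 2`. For the proof one considers, among all `lam`
in the simplex and all `z ≥ z₀` at which the derivative is nonnegative, a pair with `z` maximal. -/
theorem densityDeriv_neg_of_forall (hb : ∀ i, 0 < b i) (hB : 1 ≤ ∑ i, b i) {s : ℝ} (hs : 0 < s)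
    {z₀ : ℝ} (hz₀ : 0 < z₀)
    (hcrit : ∀ lam : Fin n → ℝ, (∀ i, 0 ≤ lam i) → ∑ i, lam i = s →
      (∑ i, lam i * b i) * ∑ i, lam i ^ 2 - ∑ i, lam i ^ 3 < z₀ * ∑ i, lam i ^ 2)
    (hl : ∀ i, 0 ≤ lam i) (hls : ∑ i, lam i = s) {z : ℝ} (hz : z₀ ≤ z) :
    densityDeriv b lam z < 0 := by
  have hne : Nonempty (Fin n) := by
    by_contra hn
    rw [not_nonempty_iff] at hn
    simp at hls
    exact hs.ne hls
  by_contra! hQ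
  set D : Set ((Fin n → ℝ) × ℝ) := {p | ((∀ i, 0 ≤ p.1 i) ∧ 0 < ∑ i, p.1 i) ∧ z₀ ≤ p.2} with hD
  have hcont : ContinuousOn (fun p : (Fin n → ℝ) × ℝ ↦ densityDeriv b p.1 p.2) D := by
    unfold densityDeriv
    exact (continuousOn_const.mul (continuousOn_kernelMean hb hz₀ (by linarith))).sub
      (continuousOn_snd.mul (continuousOn_kernelMean hb hz₀ (by linarith)))
  set K : Set ((Fin n → ℝ) × ℝ) := {p | ((∀ i, 0 ≤ p.1 i) ∧ ∑ i, p.1 i = s) ∧ z₀ ≤ p.2} with hK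
  have hKD : K ⊆ D := fun p hp ↦ ⟨⟨hp.1.1, hp.1.2 ▸ hs⟩, hp.2⟩
  have hKc : IsClosed K := by
    have h1 : IsClosed (⋂ i, {p : (Fin n → ℝ) × ℝ | 0 ≤ p.1 i}) :=
      isClosed_iInter fun i ↦ isClosed_le (by fun_prop) (by fun_prop)
    have h2 : IsClosed {p : (Fin n → ℝ) × ℝ | ∑ i, p.1 i = s} :=
      isClosed_eq (by fun_prop) (by fun_prop)
    have h3 : IsClosed {p : (Fin n → ℝ) × ℝ | z₀ ≤ p.2} :=
      isClosed_le (by fun_prop) (by fun_prop)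
    convert (h1.inter h2).inter h3 using 1
    ext p
    simp [hK]
  set S : Set ((Fin n → ℝ) × ℝ) := K ∩ (fun p ↦ densityDeriv b p.1 p.2) ⁻¹' Set.Ici 0 with hS
  have hSc : IsClosed S := (hcont.mono hKD).preimage_isClosed_of_isClosed hKc isClosed_Ici
  have hSz : ∀ p ∈ S, p.2 ≤ (∑ i, b i - 1) * s := fun p hp ↦ by
    have hp1 := hKD hp.1
    have := le_of_densityDeriv_nonneg hb hB hp1.1.1 hp1.1.2 (hz₀.trans_le hp1.2) hp.2
    rwa [hp.1.1.2] at this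
  have hScomp : IsCompact S := by
    refine (isCompact_Icc (a := ((fun _ ↦ 0, z₀) : (Fin n → ℝ) × ℝ))
      (b := (fun _ ↦ s, (∑ i, b i - 1) * s))).of_isClosed_subset hSc fun p hp ↦ ?_
    refine ⟨⟨hp.1.1.1, hp.1.2⟩, ⟨fun i ↦ ?_, hSz p hp⟩⟩
    rw [← hp.1.1.2]
    exact Finset.single_le_sum (f := p.1) (fun j _ ↦ hp.1.1.1 j) (Finset.mem_univ i)
  obtain ⟨⟨l, y⟩, hp, hmax⟩ := hScomp.exists_isMaxOn ⟨(lam, z), ⟨⟨⟨hl, hls⟩, hz⟩, hQ⟩⟩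
    continuousOn_snd
  have hl0 : ∀ i, 0 ≤ l i := hp.1.1.1
  have hlsum : ∑ i, l i = s := hp.1.1.2
  have hzy : z₀ ≤ y := hp.1.2
  have hy : 0 < y := hz₀.trans_le hzy
  have hls0 : 0 < ∑ i, l i := hlsum ▸ hs
  -- No point of the simplex has a positive derivative at the maximal `y`: by continuity the
  -- derivative would still be positive slightly beyond `y`.
  have hle : ∀ m : Fin n → ℝ, (∀ i, 0 ≤ m i) → ∑ i, m i = s → densityDeriv b m y ≤ 0 := by
    intro m hm hms
    by_contra! hpos
    have hc : ContinuousOn (fun t ↦ densityDeriv b m t) (Set.Ici y) :=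
      hcont.comp (f := fun t ↦ ((m, t) : (Fin n → ℝ) × ℝ)) (by fun_prop)
        fun t ht ↦ ⟨⟨hm, hms ▸ hs⟩, hzy.trans ht⟩
    have hev : ∀ᶠ t in nhdsWithin y (Set.Ioi y), 0 < densityDeriv b m t :=
      ((hc y Set.self_mem_Ici).mono Set.Ioi_subset_Ici_self).eventually_const_lt hpos
    obtain ⟨t, ht, hty⟩ := (hev.and self_mem_nhdsWithin).exists
    have hty : y < t := hty
    have : t ≤ y := hmax (show (m, t) ∈ S from ⟨⟨⟨hm, hms⟩, hzy.trans hty.le⟩, ht.le⟩)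
    exact absurd this (not_le.2 hty)
  have hQ0 : densityDeriv b l y = 0 := le_antisymm (hle l hl0 hlsum) hp.2
  have hstat : ∀ k m, 0 < l k → 0 < l m →
      b k / (∑ i, b i) * densityDerivTwo b l y k = b m / (∑ i, b i) * densityDerivTwo b l y m := by
    intro k m hk hm
    rcases eq_or_ne k m with rfl | hkm
    · rfl
    set w : Fin n → ℝ := Pi.single k 1 - Pi.single m 1 with hw
    have hwsum : ∑ i, w i = 0 := by simp [hw]
    have hsum : ∀ t : ℝ, ∑ i, (l i + t * w i) = s := fun t ↦ by
      rw [Finset.sum_add_distrib, ← Finset.mul_sum, hwsum, hlsum]; ring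
    have hnn : ∀ᶠ t in nhds (0 : ℝ), ∀ i, 0 ≤ l i + t * w i := by
      refine Filter.eventually_all.2 fun i ↦ ?_
      rcases (hl0 i).eq_or_lt with h | h
      · have hik : i ≠ k := by rintro rfl; exact hk.ne h
        have him : i ≠ m := by rintro rfl; exact hm.ne h
        simp [hw, hik, him, ← h]
      · have hc : Continuous fun t : ℝ ↦ l i + t * w i := by fun_prop
        have := hc.tendsto 0
        simp only [zero_mul, add_zero] at this
        exact (this.eventually_const_lt h).mono fun t ht ↦ ht.le
    have hder := hasDerivAt_densityDeriv hb (lam := l) (w := w) (t₀ := 0)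
      (hnn.mono fun t ht ↦ ⟨ht, by rw [hsum]; exact hs⟩) hy
    have hloc : IsLocalMax (fun t ↦ densityDeriv b (fun i ↦ l i + t * w i) y) 0 := by
      filter_upwards [hnn] with t ht
      simp only [zero_mul, add_zero]
      rw [hQ0]
      exact hle _ ht (hsum t)
    have h0 := hloc.hasDerivAt_eq_zero hder
    simp only [zero_mul, add_zero] at h0
    simp [hw, sub_mul, Finset.sum_sub_distrib, Pi.single_apply] at h0
    linarith
  obtain ⟨k₀, _, hk₀⟩ := Finset.exists_lt_of_sum_lt (by simpa using hls0 :
    ∑ i, (0 : ℝ) < ∑ i, l i)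
  obtain ⟨d, hd⟩ : ∃ d, d = b k₀ / (∑ i, b i) * densityDerivTwo b l y k₀ := ⟨_, rfl⟩
  have hBpos : 0 < ∑ i, b i := by linarith
  have hk : ∀ k, l k ^ 2 * ((∑ i, b i) * d) =
      b k * (y * ((∑ i, b i) * kernelMean b l y (∑ i, b i) -
        y * kernelMean (b + Pi.single k 1) l y (∑ i, b i + 1))) := by
    intro k
    have h1 := sq_mul_densityDerivTwo hb hl0 hls0 k hy hQ0
    rw [← h1]
    rcases (hl0 k).eq_or_lt with h | h
    · simp [← h]
    · rw [hd, ← hstat k k₀ h hk₀]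
      field_simp
  have hM := kernelMean_pos hb hl0 hls0 hy hBpos
  have e1 := sum_mul_kernelMean_add_single hb hl0 hls0 hy (by linarith : 0 < ∑ i, b i + 1)
  have e2 := sum_mul_mul_kernelMean_add_single hb hl0 hls0 hy hBpos
  have hc := hcrit l hl0 hlsum
  rw [densityDeriv] at hQ0
  set B := ∑ i, b i with hBdef
  set M := kernelMean b l y B
  have s2 : d * ∑ k, l k ^ 2 = y * M := by
    have : ∑ k, l k ^ 2 * (B * d) = ∑ k, (b k * (y * (B * M)) -
        y ^ 2 * (b k * kernelMean (b + Pi.single k 1) l y (B + 1))) :=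
      Finset.sum_congr rfl fun k _ ↦ by rw [hk]; ring
    rw [← Finset.sum_mul, Finset.sum_sub_distrib, ← Finset.sum_mul, ← Finset.mul_sum, e1,
      ← hBdef] at this
    refine mul_left_cancel₀ hBpos.ne' ?_
    linear_combination this + B * y * hQ0
  have s3 : d * ∑ k, l k ^ 3 = y * M * (∑ k, l k * b k - y) := by
    have : ∑ k, l k ^ 3 * (B * d) = ∑ k, (l k * b k * (y * (B * M)) -
        y ^ 2 * (l k * (b k * kernelMean (b + Pi.single k 1) l y (B + 1)))) :=
      Finset.sum_congr rfl fun k _ ↦ by linear_combination l k * hk k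
    rw [← Finset.sum_mul, Finset.sum_sub_distrib, ← Finset.sum_mul, ← Finset.mul_sum, e2] at this
    refine mul_left_cancel₀ hBpos.ne' ?_
    linear_combination this
  have hyM : 0 < y * M := mul_pos hy hM
  have h4 : ∑ k, l k ^ 3 = (∑ k, l k * b k - y) * ∑ k, l k ^ 2 := by
    refine mul_left_cancel₀ hyM.ne' ?_
    linear_combination (-∑ k, l k ^ 3) * s2 + (∑ k, l k ^ 2) * s3
  have h5 : z₀ * ∑ k, l k ^ 2 ≤ y * ∑ k, l k ^ 2 :=
    mul_le_mul_of_nonneg_right hzy (Finset.sum_nonneg fun k _ ↦ sq_nonneg _)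
  rw [h4] at hc
  linarith

/-- If two of the shapes are `α + 1` and the others are `α`, the density decreases beyond
`(α + 1 / 2) * s`. -/
theorem densityDeriv_neg {α : ℝ} (hα : 0 < α) {i j : Fin n} (hij : i ≠ j) {s : ℝ} (hs : 0 < s)
    (hl : ∀ i, 0 ≤ lam i) (hls : ∑ i, lam i = s) {z : ℝ} (hz : (α + 1 / 2) * s < z) :
    densityDeriv ((fun _ ↦ α) + Pi.single i 1 + Pi.single j 1) lam z < 0 := by
  have hb : ∀ k, 0 < ((fun _ ↦ α) + Pi.single i 1 + Pi.single j 1 : Fin n → ℝ) k :=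
    add_single_pos (add_single_pos (fun _ ↦ hα) i) j
  refine densityDeriv_neg_of_forall hb ?_ hs (lt_trans (by positivity) hz)
    ?_ hl hls le_rfl
  · rw [sum_add_single, sum_add_single]
    have : 0 ≤ ∑ k : Fin n, α := Finset.sum_nonneg fun _ _ ↦ hα.le
    linarith
  · intro m hm hms
    have e : ∑ k, m k * ((fun _ ↦ α) + Pi.single i 1 + Pi.single j 1 : Fin n → ℝ) k =
        α * s + m i + m j := by
      simp [mul_add, Finset.sum_add_distrib, Pi.single_apply, mul_comm, ← Finset.mul_sum, hms]
    rw [e]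
    -- With `T = m i + m j`, it suffices that `s * (T - s / 2) ≤ T ^ 2 / 2 ≤ ∑ k, m k ^ 2`, since
    -- `(∑ k, m k ^ 2) ^ 2 ≤ s * ∑ k, m k ^ 3`.
    have hp : 0 < ∑ k, m k ^ 2 := by
      refine lt_of_le_of_ne (Finset.sum_nonneg fun k _ ↦ sq_nonneg _) fun h ↦ ?_
      have h0 := (Finset.sum_eq_zero_iff_of_nonneg fun k _ ↦ sq_nonneg (m k)).1 h.symm
      have : ∑ k, m k = 0 := Finset.sum_eq_zero fun k hk ↦ by simpa using h0 k hk
      linarith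
    have cs : (∑ k, m k ^ 2) ^ 2 ≤ (∑ k, m k) * ∑ k, m k ^ 3 :=
      Finset.sum_sq_le_sum_mul_sum_of_sq_le_mul _ (fun k _ ↦ hm k)
        (fun k _ ↦ pow_nonneg (hm k) 3) fun k _ ↦ (by ring : _ = _).le
    rw [hms] at cs
    have h2 : m i ^ 2 + m j ^ 2 ≤ ∑ k, m k ^ 2 := by
      rw [← Finset.sum_pair hij (f := fun k ↦ m k ^ 2)]
      exact Finset.sum_le_univ_sum_of_nonneg fun k ↦ sq_nonneg _
    have h3 : s * (m i + m j - s / 2) ≤ ∑ k, m k ^ 2 := by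
      nlinarith [sq_nonneg (m i + m j - s), sq_nonneg (m i - m j)]
    have h4 : s * ((m i + m j - s / 2) * ∑ k, m k ^ 2) ≤ s * ∑ k, m k ^ 3 := by
      nlinarith [mul_le_mul_of_nonneg_right h3 hp.le]
    have h5 := le_of_mul_le_mul_left h4 hs
    have h6 := mul_lt_mul_of_pos_right hz hp
    linarith

end

/-! ### Variation of the distribution function along a segment of weights -/

theorem gammaPDFReal_integrable {A : ℝ} (hA : 0 < A) : Integrable (gammaPDFReal A 1) := by
  refine ⟨by fun_prop, ?_⟩
  rw [hasFiniteIntegral_iff_ofReal (ae_of_all _ (gammaPDFReal_nonneg hA one_pos))]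
  exact (lintegral_gammaPDF_eq_one hA one_pos).trans_lt ENNReal.one_lt_top

theorem gammaMeasure_real_Iio {A : ℝ} (hA : 0 < A) (y : ℝ) :
    (gammaMeasure A 1).real (Set.Iio y) = ∫ t in Set.Iic y, gammaPDFReal A 1 t := by
  have := isProbabilityMeasure_gammaMeasure hA one_pos
  rw [← cdf_gammaMeasure_eq_integral hA one_pos, cdf_eq_real]
  refine measureReal_congr ?_
  exact (withDensity_absolutelyContinuous _ _).ae_eq Iio_ae_eq_Iic

theorem hasDerivAt_gammaMeasure_real_Iio_div {A : ℝ} (hA : 0 < A) {x : ℝ} (hx : 0 < x) {v : ℝ}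
    (hv : 0 < v) :
    HasDerivAt (fun v ↦ (gammaMeasure A 1).real (Set.Iio (x / v)))
      (-(x ^ A / Real.Gamma A) * invKernel x (A + 1) v) v := by
  have hint := gammaPDFReal_integrable hA
  have hy : 0 < x / v := div_pos hx hv
  have e : (fun y ↦ (gammaMeasure A 1).real (Set.Iio y)) =
      fun y ↦ (∫ t in Set.Iic 0, gammaPDFReal A 1 t) + ∫ t in (0)..y, gammaPDFReal A 1 t := by
    ext y
    rw [gammaMeasure_real_Iio hA,
      ← intervalIntegral.integral_Iic_sub_Iic hint.integrableOn hint.integrableOn]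
    ring
  have hc : ContinuousAt (gammaPDFReal A 1) (x / v) := by
    have h1 : ContinuousAt (fun t ↦ 1 ^ A / Real.Gamma A * t ^ (A - 1) * Real.exp (-(1 * t)))
        (x / v) :=
      (continuousAt_const.mul (continuousAt_id.rpow_const (Or.inl hy.ne'))).mul
        (by fun_prop)
    refine h1.congr ?_
    filter_upwards [lt_mem_nhds hy] with t ht
    simp [gammaPDFReal, ht.le]
  have h1 : HasDerivAt (fun y ↦ (gammaMeasure A 1).real (Set.Iio y))
      (gammaPDFReal A 1 (x / v)) (x / v) := by
    rw [e]
    exact (intervalIntegral.integral_hasDerivAt_right hint.intervalIntegrable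
      (stronglyMeasurable_gammaPDFReal A 1).stronglyMeasurableAtFilter hc).const_add _
  have h2 := (hasDerivAt_const v x).fun_div (hasDerivAt_id' v) hv.ne'
  refine (HasDerivAt.comp v h1 h2).congr_deriv ?_
  simp only [gammaPDFReal, hy.le, if_true, invKernel]
  rw [Real.rpow_sub_one hy.ne', Real.div_rpow hx.le hv.le, Real.one_rpow, one_mul,
    Real.rpow_neg hv.le, Real.rpow_add_one hv.ne']
  have := (Real.rpow_pos_of_pos hv A).ne'
  field_simp
  ring

section

variable {n : ℕ} {a lam : Fin n → ℝ}

theorem hasDerivAt_gammaProd_real [Nonempty (Fin n)] (ha : ∀ i, 0 < a i) {w : Fin n → ℝ} {t₀ : ℝ}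
    (hL : ∀ᶠ t in nhds t₀, (∀ i, 0 ≤ lam i + t * w i) ∧ 0 < ∑ i, (lam i + t * w i))
    {x : ℝ} (hx : 0 < x) :
    HasDerivAt (fun t ↦ (gammaProd a).real {g | ∑ i, (lam i + t * w i) * g i < x})
      (-(x ^ (∑ i, a i) / (Real.Gamma (∑ i, a i) * ∑ i, a i) * ∑ k, w k * (a k *
        kernelMean (a + Pi.single k 1) (fun i ↦ lam i + t₀ * w i) x (∑ i, a i + 1)))) t₀ := by
  have hA : 0 < ∑ i, a i := Finset.sum_pos (fun i _ ↦ ha i) Finset.univ_nonempty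
  have := isProbabilityMeasure_gammaMeasure hA one_pos
  obtain ⟨C, hC⟩ := exists_abs_invKernel_le hx (by linarith : 0 < ∑ i, a i + 1)
  have hG : 0 < x ^ (∑ i, a i) / Real.Gamma (∑ i, a i) :=
    div_pos (Real.rpow_pos_of_pos hx _) (Real.Gamma_pos_of_pos hA)
  have hmono : Measurable fun y ↦ (gammaMeasure (∑ i, a i) 1).real (Set.Iio y) :=
    Monotone.measurable fun y z h ↦ measureReal_mono (Set.Iio_subset_Iio h)
  have key := hasDerivAt_integral_weighted_mean ha hL
    (fun v hv ↦ hasDerivAt_gammaMeasure_real_Iio_div hA hx hv)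
    (hmono.comp (by fun_prop)) (by fun_prop)
    (C := max 1 (x ^ (∑ i, a i) / Real.Gamma (∑ i, a i) * C))
    (fun v _ ↦ by
      rw [abs_of_nonneg measureReal_nonneg]
      exact measureReal_le_one.trans (le_max_left _ _))
    (fun v hv ↦ by
      rw [abs_mul, abs_neg, abs_of_pos hG]
      exact (mul_le_mul_of_nonneg_left (hC v hv) hG.le).trans (le_max_right _ _))
  refine (key.congr_of_eventuallyEq ?_).congr_deriv ?_
  · filter_upwards [hL] with t ht
    exact gammaProd_real_sum_mul_lt ha ht.1 ht.2 x
  · rw [Finset.mul_sum, ← Finset.sum_neg_distrib]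
    refine Finset.sum_congr rfl fun k _ ↦ ?_
    rw [mul_kernelMean_add_single ha]
    simp_rw [mul_left_comm _ (-_) (invKernel _ _ _)]
    rw [integral_const_mul]
    have := (Real.Gamma_pos_of_pos hA).ne'
    field_simp

theorem continuousOn_gammaProd_real [Nonempty (Fin n)] (ha : ∀ i, 0 < a i) {w : Fin n → ℝ}
    {s : Set ℝ} (hL : ∀ t ∈ s, (∀ i, 0 ≤ lam i + t * w i) ∧ 0 < ∑ i, (lam i + t * w i))
    {x : ℝ} (hx : 0 < x) :
    ContinuousOn (fun t ↦ (gammaProd a).real {g | ∑ i, (lam i + t * w i) * g i < x}) s := by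
  have hA : 0 < ∑ i, a i := Finset.sum_pos (fun i _ ↦ ha i) Finset.univ_nonempty
  have := isProbabilityMeasure_gammaMeasure hA one_pos
  have := isProbabilityMeasure_dirichlet ha
  have hmono : Measurable fun y ↦ (gammaMeasure (∑ i, a i) 1).real (Set.Iio y) :=
    Monotone.measurable fun y z h ↦ measureReal_mono (Set.Iio_subset_Iio h)
  refine ContinuousOn.congr ?_ fun t ht ↦
    gammaProd_real_sum_mul_lt ha (hL t ht).1 (hL t ht).2 x
  refine continuousOn_of_dominated (bound := fun _ ↦ 1)
    (fun t _ ↦ (hmono.comp (by fun_prop)).aestronglyMeasurable)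
    (fun t _ ↦ ae_of_all _ fun u ↦ ?_) (integrable_const _) ?_
  · rw [Real.norm_eq_abs, abs_of_nonneg measureReal_nonneg]
    exact measureReal_le_one
  · filter_upwards [dirichlet_ae ha] with u hu t ht
    have hv := (weighted_mean_mem (hL t ht).1 (hL t ht).2 hu).1
    have hc : ContinuousAt (fun t ↦ ∑ i, (lam i + t * w i) * u i) t := by fun_prop
    exact (ContinuousAt.comp (g := fun v ↦ (gammaMeasure (∑ i, a i) 1).real (Set.Iio (x / v)))
      (f := fun t ↦ ∑ i, (lam i + t * w i) * u i) (hasDerivAt_gammaMeasure_real_Iio_div hA hx hv).continuousAt hc).continuousWithinAt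

end

/-! ### Majorization -/

theorem sum_filter_val_lt {n : ℕ} (g : ℕ → ℝ) {k : ℕ} (hk : k ≤ n) :
    ∑ i : Fin n with i.val < k, g i = ∑ i ∈ Finset.range k, g i := by
  rw [Finset.sum_filter, Fin.sum_univ_eq_sum_range (fun i ↦ if i < k then g i else 0) n,
    ← Finset.sum_filter]
  refine Finset.sum_congr ?_ fun _ _ ↦ rfl
  ext i
  simp only [Finset.mem_filter, Finset.mem_range]
  omega

theorem Majorizes.sum_mul_le_of_antitone {n : ℕ} {lam mu : Fin n → ℝ} (h : Majorizes lam mu)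
    {c : Fin n → ℝ} (hc : Antitone c) : ∑ i, mu i * c i ≤ ∑ i, lam i * c i := by
  set d : ℕ → ℝ := fun i ↦ if hi : i < n then lam ⟨i, hi⟩ - mu ⟨i, hi⟩ else 0 with hd
  set e : ℕ → ℝ := fun i ↦ if hi : i < n then c ⟨i, hi⟩ else 0 with he
  have hd' : ∀ i : Fin n, d i = lam i - mu i := fun i ↦ by simp [hd]
  have he' : ∀ i : Fin n, e i = c i := fun i ↦ by simp [he]
  have hpart : ∀ k < n, 0 ≤ ∑ i ∈ Finset.range k, d i := fun k hk ↦ by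
    rw [← sum_filter_val_lt d hk.le]
    simp_rw [hd']
    rw [Finset.sum_sub_distrib]
    linarith [h.partial_sum_le k hk]
  have htot : ∑ i ∈ Finset.range n, d i = 0 := by
    rw [← Fin.sum_univ_eq_sum_range]
    simp_rw [hd']
    rw [Finset.sum_sub_distrib]
    linarith [h.sum_eq]
  have key : 0 ≤ ∑ i ∈ Finset.range n, e i • d i := by
    rw [Finset.sum_range_by_parts, htot, smul_zero, zero_sub, ← Finset.sum_neg_distrib]
    refine Finset.sum_nonneg fun i hi ↦ ?_
    have hi : i + 1 < n := by simp at hi; omega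
    have h1 : e (i + 1) - e i ≤ 0 := by
      have := hc (show (⟨i, by omega⟩ : Fin n) ≤ ⟨i + 1, hi⟩ by simp)
      simp only [he, hi, (by omega : i < n), dif_pos]
      linarith
    rw [smul_eq_mul, ← neg_mul]
    exact mul_nonneg (by linarith) (hpart _ hi)
  rw [← Fin.sum_univ_eq_sum_range (fun i ↦ e i • d i)] at key
  simp_rw [hd', he', smul_eq_mul, mul_sub] at key
  rw [Finset.sum_sub_distrib] at key
  simp_rw [mul_comm (c _)] at key
  linarith

section

variable {n : ℕ} {lam mu : Fin n → ℝ} {α : ℝ}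

/-- Raising one of two equal shapes: the densities for the two choices differ by a multiple of the
derivative of the density for which both shapes are raised. -/
theorem kernelMean_sub_kernelMean (hα : 0 < α) (hl : ∀ i, 0 ≤ lam i) (hs : 0 < ∑ i, lam i)
    (i j : Fin n) {x : ℝ} (hx : 0 < x) :
    (∑ _ : Fin n, α + 1) *
      (kernelMean ((fun _ ↦ α) + Pi.single i 1) lam x (∑ _ : Fin n, α + 1) -
        kernelMean ((fun _ ↦ α) + Pi.single j 1) lam x (∑ _ : Fin n, α + 1)) =
      (lam j - lam i) * densityDeriv ((fun _ ↦ α) + Pi.single i 1 + Pi.single j 1) lam x := by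
  have h1 := sum_mul_kernelMean_eq (add_single_pos (fun _ ↦ hα) i) hl hs j hx
  have h2 := sum_mul_kernelMean_eq (add_single_pos (fun _ ↦ hα) j) hl hs i hx
  rw [add_right_comm] at h2
  rw [sum_add_single] at h1 h2
  linear_combination h1 - h2

theorem Majorizes.segment (h : Majorizes lam mu) (hs : 0 < ∑ i, lam i) {t : ℝ}
    (ht : t ∈ Set.Icc (0 : ℝ) 1) :
    ((∀ i, 0 ≤ lam i + t * (mu i - lam i)) ∧ 0 < ∑ i, (lam i + t * (mu i - lam i))) ∧
      ∑ i, (lam i + t * (mu i - lam i)) = ∑ i, lam i ∧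
      Antitone fun i ↦ lam i + t * (mu i - lam i) := by
  have hsum : ∑ i, (lam i + t * (mu i - lam i)) = ∑ i, lam i := by
    rw [Finset.sum_add_distrib, ← Finset.mul_sum, Finset.sum_sub_distrib, h.sum_eq]
    ring
  have h0 : 0 ≤ t := ht.1
  have h1 : 0 ≤ 1 - t := by linarith [ht.2]
  refine ⟨⟨fun i ↦ ?_, hsum ▸ hs⟩, hsum, fun i j hij ↦ ?_⟩
  · nlinarith [mul_nonneg h1 (h.nonneg i), mul_nonneg h0 (h.pos i).le]
  · have e1 := mul_le_mul_of_nonneg_left (h.antitone_left hij) h1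
    have e2 := mul_le_mul_of_nonneg_left (h.antitone_right hij) h0
    simp only
    linarith

/-- Comparison of the distribution functions at the two ends of the segment from `lam` to `mu`: the
sum in `hσ` is a negative multiple of the derivative along the segment, so `σ` times the
distribution function increases. The lemma is used with `σ = 1` and `σ = -1`. -/
theorem Majorizes.mul_gammaProd_real_le (h : Majorizes lam mu) (hα : 0 < α)
    (hs : 0 < ∑ i, lam i) {x : ℝ} (hx : 0 < x) (σ : ℝ)
    (hσ : ∀ m : Fin n → ℝ, (∀ i, 0 ≤ m i) → ∑ i, m i = ∑ i, lam i → Antitone m →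
      σ * ∑ k, (mu k - lam k) *
        kernelMean ((fun _ ↦ α) + Pi.single k 1) m x (∑ _ : Fin n, α + 1) ≤ 0) :
    σ * (gammaProd fun _ ↦ α).real {g : Fin n → ℝ | ∑ i, lam i * g i < x} ≤
      σ * (gammaProd fun _ ↦ α).real {g : Fin n → ℝ | ∑ i, mu i * g i < x} := by
  have hne : Nonempty (Fin n) := by
    by_contra hn
    rw [not_nonempty_iff] at hn
    simp at hs
  have ha : ∀ _ : Fin n, 0 < α := fun _ ↦ hα
  have hA : 0 < ∑ _ : Fin n, α := Finset.sum_pos (fun _ _ ↦ hα) Finset.univ_nonempty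
  set G : ℝ → ℝ := fun t ↦ σ * (gammaProd fun _ ↦ α).real
    {g : Fin n → ℝ | ∑ i, (lam i + t * (mu i - lam i)) * g i < x} with hG
  have hcont : ContinuousOn G (Set.Icc 0 1) :=
    continuousOn_const.mul (continuousOn_gammaProd_real ha (fun t ht ↦ (h.segment hs ht).1) hx)
  have hder : ∀ t ∈ Set.Ioo (0 : ℝ) 1, ∃ d, 0 ≤ d ∧ HasDerivAt G d t := fun t ht ↦ by
    have hL : ∀ᶠ t in nhds t, (∀ i, 0 ≤ lam i + t * (mu i - lam i)) ∧
        0 < ∑ i, (lam i + t * (mu i - lam i)) := by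
      filter_upwards [Icc_mem_nhds ht.1 ht.2] with t ht using (h.segment hs ht).1
    refine ⟨_, ?_, (hasDerivAt_gammaProd_real ha hL hx).const_mul σ⟩
    have hm := h.segment hs (Set.Ioo_subset_Icc_self ht)
    have hσt := hσ _ hm.1.1 hm.2.1 hm.2.2
    have hK : 0 < x ^ (∑ _ : Fin n, α) / (Real.Gamma (∑ _ : Fin n, α) * ∑ _ : Fin n, α) :=
      div_pos (Real.rpow_pos_of_pos hx _) (mul_pos (Real.Gamma_pos_of_pos hA) hA)
    simp_rw [mul_left_comm _ α, ← Finset.mul_sum]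
    rw [mul_neg, neg_nonneg, mul_left_comm, mul_left_comm σ α]
    exact mul_nonpos_of_nonneg_of_nonpos hK.le (mul_nonpos_of_nonneg_of_nonpos hα.le hσt)
  have hmono : MonotoneOn G (Set.Icc 0 1) := by
    refine monotoneOn_of_deriv_nonneg (convex_Icc 0 1) hcont ?_ ?_ <;> rw [interior_Icc]
    · intro t ht
      obtain ⟨d, _, hd⟩ := hder t ht
      exact hd.differentiableAt.differentiableWithinAt
    · intro t ht
      obtain ⟨d, hd0, hd⟩ := hder t ht
      rwa [hd.deriv]
  simpa [hG] using hmono (Set.left_mem_Icc.2 zero_le_one) (Set.right_mem_Icc.2 zero_le_one)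
    zero_le_one

theorem Majorizes.gammaProd_real_le (h : Majorizes lam mu) (hα : 0 < α) (hs : 0 < ∑ i, lam i)
    {x : ℝ} (hx : (α + 1 / 2) * ∑ i, lam i < x) :
    (gammaProd fun _ ↦ α).real {g : Fin n → ℝ | ∑ i, lam i * g i < x} ≤
      (gammaProd fun _ ↦ α).real {g : Fin n → ℝ | ∑ i, mu i * g i < x} := by
  have hx0 : 0 < x := lt_trans (by positivity) hx
  have key := h.mul_gammaProd_real_le hα hs hx0 1 fun m hm hms hanti ↦ ?_
  · simpa using key
  · have hc : Antitone fun k ↦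
        kernelMean ((fun _ ↦ α) + Pi.single k 1) m x (∑ _ : Fin n, α + 1) := fun i j hij ↦ by
      rcases hij.eq_or_lt with rfl | hlt
      · rfl
      have e := kernelMean_sub_kernelMean hα hm (hms ▸ hs) i j hx0
      have hQ := densityDeriv_neg hα hlt.ne hs hm hms hx
      have hA : 0 < ∑ _ : Fin n, α + 1 := by
        have : 0 ≤ ∑ _ : Fin n, α := Finset.sum_nonneg fun _ _ ↦ hα.le
        linarith
      have h0 := mul_nonneg_of_nonpos_of_nonpos (sub_nonpos.2 (hanti hij)) hQ.le
      rw [← e] at h0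
      exact sub_nonneg.1 (nonneg_of_mul_nonneg_right h0 hA)
    have := h.sum_mul_le_of_antitone hc
    simp_rw [one_mul, sub_mul]
    rw [Finset.sum_sub_distrib]
    linarith

theorem Majorizes.gammaProd_real_ge (h : Majorizes lam mu) (hα : 0 < α) (hs : 0 < ∑ i, lam i)
    {x : ℝ} (hx0 : 0 < x)
    (hQ : ∀ m : Fin n → ℝ, (∀ i, 0 ≤ m i) → ∑ i, m i = ∑ i, lam i → ∀ i j, i ≠ j →
      0 ≤ densityDeriv ((fun _ ↦ α) + Pi.single i 1 + Pi.single j 1) m x) :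
    (gammaProd fun _ ↦ α).real {g : Fin n → ℝ | ∑ i, mu i * g i < x} ≤
      (gammaProd fun _ ↦ α).real {g : Fin n → ℝ | ∑ i, lam i * g i < x} := by
  have key := h.mul_gammaProd_real_le hα hs hx0 (-1) fun m hm hms hanti ↦ ?_
  · linarith
  · have hc : Antitone fun k ↦
        -kernelMean ((fun _ ↦ α) + Pi.single k 1) m x (∑ _ : Fin n, α + 1) := fun i j hij ↦ by
      rcases hij.eq_or_lt with rfl | hlt
      · rfl
      have e := kernelMean_sub_kernelMean hα hm (hms ▸ hs) i j hx0
      have hA : 0 < ∑ _ : Fin n, α + 1 := by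
        have : 0 ≤ ∑ _ : Fin n, α := Finset.sum_nonneg fun _ _ ↦ hα.le
        linarith
      have h0 := mul_nonpos_of_nonpos_of_nonneg (sub_nonpos.2 (hanti hij))
        (hQ m hm hms i j hlt.ne)
      rw [← e] at h0
      exact neg_le_neg (sub_nonpos.1 (nonpos_of_mul_nonpos_right h0 hA))
    have := h.sum_mul_le_of_antitone hc
    simp_rw [sub_mul]
    rw [Finset.sum_sub_distrib]
    simp only [mul_neg, Finset.sum_neg_distrib] at this
    linarith

end

/-! ### The comparison of distribution functions -/

theorem combProb_eq_gammaProd {Ω : Type*} [MeasurableSpace Ω] (P : Measure Ω)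
    {n : ℕ} {α β : ℝ} (hα : 0 < α) (hβ : 0 < β) {X : Fin n → Ω → ℝ}
    (hX : ∀ i, HasLaw (X i) (gammaMeasure α β) P) (hindep : iIndepFun X P) (lam : Fin n → ℝ)
    (x : ℝ) : combProb P X lam x =
      (gammaProd fun _ ↦ α).real {g : Fin n → ℝ | ∑ i, lam i * g i < β * x} := by
  have hlaw := hindep.hasLaw_pi hX
  have hm : MeasurableSet {g : Fin n → ℝ | ∑ i, lam i * g i < x} :=
    measurableSet_lt (by fun_prop) (by fun_prop)
  have h1 : combProb P X lam x =
      (Measure.pi fun _ : Fin n ↦ gammaMeasure α β).real {g | ∑ i, lam i * g i < x} := by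
    rw [← hlaw.map_eq, measureReal_def, Measure.map_apply_of_aemeasurable hlaw.aemeasurable hm]
    rfl
  rw [h1, pi_gammaMeasure_eq_map_smul (fun _ ↦ hα) hβ, measureReal_def,
    Measure.map_apply (by fun_prop) hm, measureReal_def]
  congr 2
  ext g
  simp only [Set.mem_preimage, Set.mem_ofPred_eq, Pi.smul_apply, smul_eq_mul,
    mul_left_comm _ β⁻¹, ← Finset.mul_sum]
  rw [inv_mul_lt_iff₀ hβ]

theorem gammaProd_real_sum_mul_lt_of_nonpos {ι : Type*} [Fintype ι] {a mu : ι → ℝ}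
    (ha : ∀ i, 0 < a i) (hmu : ∀ i, 0 ≤ mu i) {x : ℝ} (hx : x ≤ 0) :
    (gammaProd a).real {g | ∑ i, mu i * g i < x} = 0 := by
  rw [measureReal_def]
  have : gammaProd a {g | ∑ i, mu i * g i < x} = 0 := by
    have h : ∀ᵐ g ∂gammaProd a, ¬ ∑ i, mu i * g i < x := by
      filter_upwards [gammaProd_ae_pos ha] with g hg
      exact not_lt.2 (hx.trans (Finset.sum_nonneg fun i _ ↦ mul_nonneg (hmu i) (hg i).le))
    simpa [ae_iff] using h
  rw [this, ENNReal.toReal_zero]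

theorem theorem1 {Ω : Type*} [MeasurableSpace Ω] (P : Measure Ω) [IsProbabilityMeasure P]
    (n : ℕ) (α β : ℝ) (hα : 0 < α) (hβ : 0 < β)
    (X : Fin n → Ω → ℝ) (hX : ∀ i, HasLaw (X i) (gammaMeasure α β) P) (hindep : iIndepFun X P)
    (lam mu : Fin n → ℝ) (hmaj : Majorizes lam mu) (s : ℝ) (hs : s = ∑ i, lam i) :
    (∀ x : ℝ, (2 * α + 1) * s / (2 * β) < x → combProb P X lam x ≤ combProb P X mu x) ∧
    (n = 2 → ∀ x : ℝ, x < α * s / β → combProb P X mu x ≤ combProb P X lam x) ∧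
    (3 ≤ n → 1 < α → ∀ x : ℝ, x < (α - 1) * s / β →
      combProb P X mu x ≤ combProb P X lam x) := by
  have hspos : 0 < n → 0 < ∑ i, lam i := fun hn ↦ by
    have : Nonempty (Fin n) := ⟨⟨0, hn⟩⟩
    rw [← hmaj.sum_eq]
    exact Finset.sum_pos (fun i _ ↦ hmaj.pos i) Finset.univ_nonempty
  simp_rw [combProb_eq_gammaProd P hα hβ hX hindep]
  subst hs
  have hshape : ∀ i j k : Fin n, ((fun _ ↦ α) + Pi.single i 1 + Pi.single j 1 : Fin n → ℝ) k =
      α + (if k = i then 1 else 0) + (if k = j then 1 else 0) := fun i j k ↦ by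
    simp [Pi.single_apply]
  refine ⟨fun x hx ↦ ?_, fun hn x hx ↦ ?_, fun hn hα1 x hx ↦ ?_⟩
  · rcases n.eq_zero_or_pos with rfl | hn
    · rw [Subsingleton.elim lam mu]
    · refine hmaj.gammaProd_real_le hα (hspos hn) ?_
      rw [div_lt_iff₀ (by positivity)] at hx
      linarith
  all_goals
    rcases le_or_gt x 0 with hx0 | hx0
    · rw [gammaProd_real_sum_mul_lt_of_nonpos (fun _ ↦ hα) (fun i ↦ (hmaj.pos i).le)
        (mul_nonpos_of_nonneg_of_nonpos hβ.le hx0)]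
      exact measureReal_nonneg
    have hs := hspos (by omega)
    have hβx : 0 < β * x := mul_pos hβ hx0
    rw [lt_div_iff₀ hβ] at hx
    refine hmaj.gammaProd_real_ge hα hs hβx fun m hm hms i j hij ↦
      (densityDeriv_pos (fun k ↦ ?_) hm (hms ▸ hs) hβx ?_).le
  · subst hn
    have : k = i ∨ k = j := by omega
    rw [hshape]
    rcases this with rfl | rfl <;> simp [hij, hij.symm, hα]
  · subst hn
    have hk : ∀ k, m k * (((fun _ ↦ α) + Pi.single i 1 + Pi.single j 1 : Fin 2 → ℝ) k - 1) =
        m k * α := fun k ↦ by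
      have : k = i ∨ k = j := by omega
      rw [hshape]
      rcases this with rfl | rfl <;> simp [hij, hij.symm]
    simp_rw [hk]
    rw [← Finset.sum_mul, hms]
    linarith
  · rw [hshape]
    split_ifs <;> linarith
  · have hle : ∑ k, m k * (α - 1) ≤
        ∑ k, m k * (((fun _ ↦ α) + Pi.single i 1 + Pi.single j 1 : Fin n → ℝ) k - 1) := by
      refine Finset.sum_le_sum fun k _ ↦ mul_le_mul_of_nonneg_left ?_ (hm k)
      rw [hshape]
      split_ifs <;> linarith
    rw [← Finset.sum_mul, hms] at hle
    linarith
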